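/- **Setting.** Write $\log$ for the natural logarithm and $\log_+(z) := 1+\log z$. Let $\mathcal X\subseteq\mathbb R^n$ be closed and convex, let $f:\mathcal X\to\mathbb R$ be convex with its minimum $f_\star$ attained at some $x_\star\in\mathcal X$, and let $\partial f(x)=\{v: f(y)\ge f(x)+\langle v,y-x\rangle\ \forall y\in\mathcal X\}$. Let $\ell:\mathcal X\to\mathbb R$ be continuous. Let $x_0\in\mathcal X$ be a (deterministic) initial point that is not a minimizer of $f$, put $d_0:=\|x_0-x_\star\|$ (Euclidean norm), and let $0<r_\epsilon\le 3d_0$, $\delta\in(0,\tfrac12)$ and $T\ge 1$ be an integer. **Algorithm (T‑DoG).** For $t=0,\dots,T-1$, $$x_{t+1}=\mathrm{Proj}_{\mathcal X}\Big(x_t-\frac{\bar r_t}{\sqrt{G'_t}}\,g_t\Big),\qquad \bar r_t:=\max\Big\{\max_{k\le t}\|x_k-x_0\|,\ r_\epsilon\Big\},$$ $$G'_t:=8^4\,\theta_{T,\delta}^2\,\log_+^2\!\Big(1+\frac{t\,\bar\ell_t^{\,2}}{\bar\ell_0^{\,2}}\Big)\big(G_{t-1}+16\,\bar\ell_t^{\,2}\big),\qquad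 \bar\ell_t:=\max_{k\le t}\ell(x_k),\quad G_t:=\sum_{k=0}^t\|g_k\|^2,\ G_{-1}:=0,$$ with $\theta_{T,\delta}:=\log\big(60\log(6T)/\delta\big)$. (In particular the algorithm uses neither $d_0$ nor the constant $L_\star$ below.) **Oracle.** The stochastic gradients satisfy, for every $k<T$: $g_k$ is $\mathcal F_{k+1}$-measurable, $\mathbb E[g_k\mid\mathcal F_k]\in\partial f(x_k)$ almost surely, and $\|g_k\|\le\ell(x_k)$ almost surely, where $(\mathcal F_k)$ is a filtration ($\mathcal F_k$ being the information available when the oracle is queried at $x_k$). This holds in particular if $g_k$ is a fresh sample, at the point $x_k$, of an oracle $\mathcal G$ with $\mathbb E[\mathcal G(x)]\in\partial f(x)$ and $\|\mathcal G(x)\|\le\ell(x)$ almost surely for each $x\in\mathcal X$. **Theorem.** Let $$L_\star:=\max\{\ell(x): x\in\mathcal X,\ \|x-x_0\|\le 3d_0\},\qquad \bar x_t:=\frac{1}{\sum_{k<t}\bar r_k}\sum_{k<t}\bar r_k x_k,$$ $$c_{\delta,r_\epsilon,T}:=\log_+\!\Big(T\,\frac{d_0L_\star}{f(x_0)-f_\star}\Big)\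 \log_+\!\Big(\frac{3d_0}{r_\epsilon}\Big)\ \log\!\Big(\frac{\log_+(T)}{\delta}\Big).$$ There are universal constants $C_1,C_2>0$ (depending on nothing at all) such that, in the above setting, with probability at least $1-2\delta$, every $\tau\in\arg\max_{0\le t\le T}\sum_{i<t}\bar r_i/\bar r_t$ satisfies $$f(\bar x_\tau)-f_\star\ \le\ C_1\,c_{\delta,r_\epsilon,T}\,\frac{d_0\sqrt{G_{\tau-1}+L_\star^2}}{T}\ \le\ C_2\,c_{\delta,r_\epsilon,T}\,\frac{d_0L_\star}{\sqrt T}.$$ -/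

import Mathlib

open MeasureTheory Real

noncomputable section

/-- The logarithm convention `log₊ z = 1 + log z`. -/
def logPlus (z : ℝ) : ℝ := 1 + Real.log z

/-- The time-uniform logarithmic factor `θ_{t,δ} = log (60 log (6t) / δ)`. -/
def theta (t : ℕ) (δ : ℝ) : ℝ := Real.log (60 * Real.log (6 * (t : ℝ)) / δ)

section Geometry

variable {n : ℕ}

/-- The subdifferential at `x` of `f : X → ℝ`, where `X ⊆ ℝⁿ` is the domain of `f`. -/
def subdifferentialOn (X : Set (EuclideanSpace ℝ (Fin n))) (f : EuclideanSpace ℝ (Fin n) → ℝ)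
    (x : EuclideanSpace ℝ (Fin n)) : Set (EuclideanSpace ℝ (Fin n)) :=
  {v | ∀ y ∈ X, f x + inner ℝ v (y - x) ≤ f y}

/-- The Euclidean projection of `y` onto `X`: a point of `X` nearest to `y`
(it exists and is unique when `X` is nonempty, closed and convex). -/
def euclideanProj (X : Set (EuclideanSpace ℝ (Fin n))) (y : EuclideanSpace ℝ (Fin n)) :
    EuclideanSpace ℝ (Fin n) :=
  Classical.epsilon fun p => p ∈ X ∧ ∀ q ∈ X, ‖y - p‖ ≤ ‖y - q‖

theorem euclideanProj_spec {X : Set (EuclideanSpace ℝ (Fin n))} (hX : IsClosed X)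
    (hne : X.Nonempty) (y : EuclideanSpace ℝ (Fin n)) :
    euclideanProj X y ∈ X ∧ ∀ q ∈ X, ‖y - euclideanProj X y‖ ≤ ‖y - q‖ := by
  apply Classical.epsilon_spec (p := fun p => p ∈ X ∧ ∀ q ∈ X, ‖y - p‖ ≤ ‖y - q‖)
  obtain ⟨p, hp, h⟩ := hX.exists_infDist_eq_dist hne y
  refine ⟨p, hp, fun q hq => ?_⟩
  rw [← dist_eq_norm, ← dist_eq_norm, ← h]
  exact Metric.infDist_le_dist_of_mem hq

/-- `r̄_t = max (max_{k ≤ t} ‖x_k - x_0‖) r_ε`. -/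
def rbar (rε : ℝ) (x : ℕ → EuclideanSpace ℝ (Fin n)) (t : ℕ) : ℝ :=
  max ((Finset.range (t + 1)).sup' Finset.nonempty_range_add_one fun k => ‖x k - x 0‖) rε

/-- `ℓ̄_t = max_{k ≤ t} ℓ(x_k)`. -/
def lbar (ℓ : EuclideanSpace ℝ (Fin n) → ℝ) (x : ℕ → EuclideanSpace ℝ (Fin n)) (t : ℕ) : ℝ :=
  (Finset.range (t + 1)).sup' Finset.nonempty_range_add_one fun k => ℓ (x k)

/-- `G_{t-1} = ∑_{k < t} ‖g_k‖²`; note the shift in the index, `gradSqSumPred g 0 = G_{-1} = 0`. -/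
def gradSqSumPred (g : ℕ → EuclideanSpace ℝ (Fin n)) (t : ℕ) : ℝ :=
  ∑ k ∈ Finset.range t, ‖g k‖ ^ 2

/-- The T-DoG denominator
`G'_t = 8⁴ θ_{T,δ}² log₊²(1 + t ℓ̄_t² / ℓ̄_0²) (G_{t-1} + 16 ℓ̄_t²)`. -/
def tdogG (ℓ : EuclideanSpace ℝ (Fin n) → ℝ) (T : ℕ) (δ : ℝ)
    (x g : ℕ → EuclideanSpace ℝ (Fin n)) (t : ℕ) : ℝ :=
  8 ^ 4 * theta T δ ^ 2 * logPlus (1 + (t : ℝ) * lbar ℓ x t ^ 2 / lbar ℓ x 0 ^ 2) ^ 2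
    * (gradSqSumPred g t + 16 * lbar ℓ x t ^ 2)

/-- The T-DoG step size `η_t = r̄_t / √G'_t`. -/
def tdogStep (ℓ : EuclideanSpace ℝ (Fin n) → ℝ) (rε : ℝ) (T : ℕ) (δ : ℝ)
    (x g : ℕ → EuclideanSpace ℝ (Fin n)) (t : ℕ) : ℝ :=
  rbar rε x t / √(tdogG ℓ T δ x g t)

/-- `x_0, …, x_T` are the iterates of `T` iterations of T-DoG (projected SGD on `X` with the T-DoG
step sizes) started at `x₀`, when the successive stochastic gradients are `g_0, …, g_{T-1}`. The
step size at time `t` involves only `x_0, …, x_t` and `g_0, …, g_{t-1}`, so this is a recursion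
that determines `x_0, …, x_T`. -/
structure IsTDoGRun (X : Set (EuclideanSpace ℝ (Fin n))) (ℓ : EuclideanSpace ℝ (Fin n) → ℝ)
    (x₀ : EuclideanSpace ℝ (Fin n)) (rε : ℝ) (T : ℕ) (δ : ℝ)
    (x g : ℕ → EuclideanSpace ℝ (Fin n)) : Prop where
  init : x 0 = x₀
  step : ∀ t < T, x (t + 1) = euclideanProj X (x t - tdogStep ℓ rε T δ x g t • g t)

/-- The weighted average `x̄_t = (∑_{k < t} r̄_k)⁻¹ ∑_{k < t} r̄_k x_k`. -/
def weightedAvg (rε : ℝ) (x : ℕ → EuclideanSpace ℝ (Fin n)) (t : ℕ) :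
    EuclideanSpace ℝ (Fin n) :=
  (∑ k ∈ Finset.range t, rbar rε x k)⁻¹ • ∑ k ∈ Finset.range t, rbar rε x k • x k

/-- `∑_{i < t} r̄_i / r̄_t`. -/
def ratioSum (rε : ℝ) (x : ℕ → EuclideanSpace ℝ (Fin n)) (t : ℕ) : ℝ :=
  ∑ i ∈ Finset.range t, rbar rε x i / rbar rε x t

/-- `τ ∈ argmax_{t ≤ T} ∑_{i < t} r̄_i / r̄_t`. -/
def IsBestIndex (rε : ℝ) (x : ℕ → EuclideanSpace ℝ (Fin n)) (T τ : ℕ) : Prop :=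
  τ ≤ T ∧ ∀ t ≤ T, ratioSum rε x t ≤ ratioSum rε x τ

/-- `L_⋆ = max {ℓ(x) : x ∈ X, ‖x - x₀‖ ≤ 3 ‖x₀ - x_⋆‖}`; for closed `X ∋ x₀` and `ℓ` continuous
on `X` this is the maximum of a continuous function on a nonempty compact set. -/
def localBound (X : Set (EuclideanSpace ℝ (Fin n))) (ℓ : EuclideanSpace ℝ (Fin n) → ℝ)
    (x₀ xs : EuclideanSpace ℝ (Fin n)) : ℝ :=
  sSup (ℓ '' {x | x ∈ X ∧ ‖x - x₀‖ ≤ 3 * ‖x₀ - xs‖})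

/-- The logarithmic factor `log₊(T d₀ L_⋆ / gap₀) · log₊(3 d₀ / r_ε) · log (log₊(T) / δ)`, where
`gap₀ = f(x₀) - f_⋆`. -/
def logFactor (T : ℕ) (δ rε d₀ Ls gap₀ : ℝ) : ℝ :=
  logPlus ((T : ℝ) * (d₀ * Ls / gap₀)) * logPlus (3 * d₀ / rε) * Real.log (logPlus (T : ℝ) / δ)

/-- `g_0, …, g_{T-1}` are the random answers of a stochastic subgradient oracle for `f : X → ℝ`,
with pointwise bound `ℓ`, to the random queries `x_0, …, x_{T-1}`. Here `ℱ k` is the information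
available when the `k`-th query is made: given it, the answer is in mean a subgradient of `f` at
`x_k`, and its norm is at most `ℓ(x_k)` almost surely. -/
structure IsOracleResponse {Ω : Type*} {m : MeasurableSpace Ω} (μ : Measure Ω)
    (ℱ : Filtration ℕ m) (X : Set (EuclideanSpace ℝ (Fin n)))
    (f ℓ : EuclideanSpace ℝ (Fin n) → ℝ) (T : ℕ)
    (x g : ℕ → Ω → EuclideanSpace ℝ (Fin n)) : Prop where
  adapted : ∀ k < T, StronglyMeasurable[ℱ (k + 1)] (g k)
  integrable : ∀ k < T, Integrable (g k) μ
  unbiased : ∀ k < T, ∀ᵐ ω ∂μ, (μ[g k | ℱ k]) ω ∈ subdifferentialOn X f (x k ω)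
  bounded : ∀ k < T, ∀ᵐ ω ∂μ, ‖g k ω‖ ≤ ℓ (x k ω)

end Geometry

end

/-! Write d = ‖x₀ - x⋆‖, L = L⋆, and let m_k be the conditional mean of g_k given `ℱ k`, a
subgradient at x_k. The only probabilistic tool is a self-normalized inequality
(`measure_exists_le_sum_inner_le`): for predictable w_k with |⟨g_k, w_k⟩| ≤ 1/2, with probability at
least 1 - p, all partial sums of ⟨g_k - m_k, w_k⟩ are at most log(1/p) plus the partial sums of
⟨g_k, w_k⟩². It holds because exp(y - y²) ≤ 1 + y for |y| ≤ 1/2, which yields an exponential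
supermartingale. It is used for two events, each failing with probability at most δ.

Stability (`exists_stability_event`). Take w_k proportional to -η_k (x_k - x⋆), stopped on leaving
the ball of radius 3d. The squared logarithm in G' makes ∑ η_k² ‖g_k‖² a small multiple of d²/θ², so
a single scale for w_k suffices. Convexity gives the drift ⟨m_k, x_k - x⋆⟩ ≥ 0, and induction on
time yields ‖x_t - x⋆‖ ≤ 2d after the start, hence r̄_t ≤ 3d. All gradients seen are then bounded by
L.

Noise (`exists_noise_event`). The size of ∑ ⟨g_k, x_k - x⋆⟩² is random, so the inequality is applied
with both signs at about log₂ T dyadic scales. Choosing the best scale afterwards bounds the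
unweighted noise sums by a multiple of d √(G + L²); the union bound costs only an iterated logarithm
of T.

On both events the argument is deterministic. Multiplying the projected-step inequality by √G'_k and
summing by parts bounds the r̄-weighted regret by r̄_τ d (8√G' + 3√G)
(`IsTDoGRun.weighted_regret_le`). A second summation by parts (`abs_sum_mul_le`) transfers the noise
bound to the weights r̄_k. Jensen's inequality then bounds (∑ r̄_k)(f(x̄_τ) - f⋆), and since r̄ at
most doubles per step, the best index has ∑ r̄_k / r̄_τ of order at least T / log₊(3d/r_ε)
(`le_mul_logPlus_of_ratio_le`). The ratio L/ℓ(x₀) hidden in G' is controlled by f(x₀) - f⋆ ≤ ℓ(x₀)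
d. -/

/-! ### Logarithmic factors -/

theorem one_le_logPlus {z : ℝ} (hz : 1 ≤ z) : 1 ≤ logPlus z := by
  have := Real.log_nonneg hz
  unfold logPlus; linarith

theorem logPlus_le_logPlus {y z : ℝ} (hy : 0 < y) (h : y ≤ z) : logPlus y ≤ logPlus z := by
  have := Real.log_le_log hy h
  unfold logPlus; linarith

theorem half_le_log_two : (1 / 2 : ℝ) ≤ Real.log 2 := by
  have := Real.log_two_gt_d9; linarith

/-- The logarithm of the confidence term is bounded below. -/
theorem half_le_log_logPlus_div {T : ℕ} {δ : ℝ} (hT : 1 ≤ T) (hδ : 0 < δ) (hδ' : δ < 1 / 2) :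
    1 / 2 ≤ Real.log (logPlus T / δ) := by
  have hL := one_le_logPlus (z := (T : ℝ)) (by exact_mod_cast hT)
  refine half_le_log_two.trans (Real.log_le_log (by norm_num) ?_)
  rw [le_div_iff₀ hδ]; linarith

theorem log_six_le_two : Real.log 6 ≤ 2 := by
  rw [Real.log_le_iff_le_exp (by norm_num)]
  have h := Real.exp_one_gt_d9
  have : Real.exp 2 = Real.exp 1 * Real.exp 1 := by rw [← Real.exp_add]; norm_num
  rw [this]; nlinarith

theorem one_le_log_six : 1 ≤ Real.log 6 := by
  rw [Real.le_log_iff_exp_le (by norm_num)]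
  have := Real.exp_one_lt_d9; linarith

theorem log_six_mul {T : ℕ} (hT : 1 ≤ T) : Real.log (6 * (T : ℝ)) = Real.log 6 + Real.log T := by
  have : (T : ℝ) ≠ 0 := by positivity
  exact Real.log_mul (by norm_num) this

theorem theta_eq {T : ℕ} {δ : ℝ} (hT : 1 ≤ T) (hδ : 0 < δ) :
    theta T δ = Real.log (60 * (Real.log 6 + Real.log T)) + Real.log (1 / δ) := by
  have h0 : 0 ≤ Real.log T := Real.log_nonneg (by exact_mod_cast hT)
  have h1 := one_le_log_six
  unfold theta
  rw [log_six_mul hT, div_eq_mul_one_div, Real.log_mul (by positivity) (by positivity)]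

/-- `θ` dominates `log (1 / δ) + 4`. -/
theorem add_le_theta {T : ℕ} {δ : ℝ} (hT : 1 ≤ T) (hδ : 0 < δ) :
    Real.log (1 / δ) + 4 ≤ theta T δ := by
  have h0 : 0 ≤ Real.log T := Real.log_nonneg (by exact_mod_cast hT)
  have h1 := one_le_log_six
  have h4 : (4 : ℝ) ≤ Real.log (60 * (Real.log 6 + Real.log T)) := by
    rw [Real.le_log_iff_exp_le (by positivity)]
    have h := Real.exp_one_lt_d9
    have e : Real.exp 4 = Real.exp 1 ^ 4 := by rw [← Real.exp_nat_mul]; norm_num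
    have : Real.exp 1 ^ 4 ≤ (2.719 : ℝ) ^ 4 := by gcongr; linarith
    rw [e]; norm_num at this ⊢; linarith
  rw [theta_eq hT hδ]; linarith

theorem four_le_theta {T : ℕ} {δ : ℝ} (hT : 1 ≤ T) (hδ : 0 < δ) (hδ' : δ < 1 / 2) :
    4 ≤ theta T δ := by
  have := add_le_theta hT hδ
  have : 0 ≤ Real.log (1 / δ) := Real.log_nonneg (by rw [le_div_iff₀ hδ]; linarith)
  linarith

/-- `θ_{T,δ}` is at most a constant times `log (log₊ T / δ)`. -/
theorem theta_le {T : ℕ} {δ : ℝ} (hT : 1 ≤ T) (hδ : 0 < δ) (hδ' : δ < 1 / 2) :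
    theta T δ ≤ 8 * Real.log (logPlus T / δ) := by
  have h0 : 0 ≤ Real.log T := Real.log_nonneg (by exact_mod_cast hT)
  have h1 := one_le_log_six
  have h2 := log_six_le_two
  have hL := one_le_logPlus (z := (T : ℝ)) (by exact_mod_cast hT)
  have hz : 2 ≤ logPlus T / δ := by rw [le_div_iff₀ hδ]; linarith
  -- As log₊ T / δ ≥ 2, seven of the eight factors absorb 2⁷ = 128, which exceeds the 120 coming
  -- from 60 (log 6 + log T) ≤ 120 log₊ T.
  have : (8 : ℝ) * Real.log (logPlus T / δ) = Real.log ((logPlus T / δ) ^ 8) := by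
    rw [Real.log_pow]; norm_num
  rw [this]
  unfold theta
  rw [log_six_mul hT]
  refine Real.log_le_log (by positivity) ?_
  calc 60 * (Real.log 6 + Real.log T) / δ ≤ 2 ^ 7 * (logPlus T / δ) := by
        rw [← mul_div_assoc]
        refine div_le_div_of_nonneg_right ?_ hδ.le
        unfold logPlus; linarith
    _ ≤ (logPlus T / δ) ^ 7 * (logPlus T / δ) := by gcongr
    _ = _ := by ring

/-- The number of scales in the union bound enters only through `log (log₊ T / δ)`. -/
theorem log_scales_le {T : ℕ} {δ : ℝ} (hT : 1 ≤ T) (hδ : 0 < δ) (hδ' : δ < 1 / 2) :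
    Real.log (2 * (Nat.log 2 (T + 1) + 1 : ℝ) / δ) ≤ 4 * Real.log (logPlus T / δ) := by
  have h0 : 0 ≤ Real.log T := Real.log_nonneg (by exact_mod_cast hT)
  have hL := one_le_logPlus (z := (T : ℝ)) (by exact_mod_cast hT)
  have hz : 2 ≤ logPlus T / δ := by rw [le_div_iff₀ hδ]; linarith
  -- From T + 1 ≤ 2T and log 2 ≥ 1/2: dividing log T by log 2 costs at most a factor 2.
  have hJ : (Nat.log 2 (T + 1) : ℝ) ≤ 1 + 2 * Real.log T := by
    have hp : 2 ^ Nat.log 2 (T + 1) ≤ T + 1 := Nat.pow_log_le_self 2 (by omega)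
    have hp' : (2 : ℝ) ^ Nat.log 2 (T + 1) ≤ 2 * T := by
      have : (T : ℝ) + 1 ≤ 2 * T := by
        have : (1 : ℝ) ≤ T := by exact_mod_cast hT
        linarith
      exact le_trans (by exact_mod_cast hp) this
    have hT' : (T : ℝ) ≠ 0 := by positivity
    have := Real.log_le_log (by positivity) hp'
    rw [Real.log_pow, Real.log_mul (by norm_num) hT'] at this
    have h2 := half_le_log_two
    by_contra! hc
    nlinarith
  have : (4 : ℝ) * Real.log (logPlus T / δ) = Real.log ((logPlus T / δ) ^ 4) := by
    rw [Real.log_pow]; norm_num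
  rw [this]
  refine Real.log_le_log (by positivity) ?_
  calc 2 * (Nat.log 2 (T + 1) + 1 : ℝ) / δ ≤ 2 ^ 3 * (logPlus T / δ) := by
        rw [← mul_div_assoc]
        refine div_le_div_of_nonneg_right ?_ hδ.le
        unfold logPlus; linarith
    _ ≤ (logPlus T / δ) ^ 3 * (logPlus T / δ) := by gcongr
    _ = _ := by ring

/-! ### Deterministic inequalities for sequences -/

/-- Summation by parts for a monotone weight and a bounded sequence. -/
theorem sum_mul_sub_succ_le {s u : ℕ → ℝ} {M : ℝ} (hs : ∀ k, s k ≤ s (k + 1)) (hs0 : 0 ≤ s 0)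
    (t : ℕ) (hu : ∀ k ≤ t, u k ≤ M) :
    ∑ k ∈ Finset.range (t + 1), s k * (u k - u (k + 1)) ≤ s t * (M - u (t + 1)) := by
  induction t with
  | zero => simp only [zero_add, Finset.sum_range_one]; gcongr; exact hu 0 le_rfl
  | succ t ih =>
    rw [Finset.sum_range_succ]
    have h1 := ih fun k hk => hu k (by omega)
    have h2 := hu (t + 1) le_rfl
    nlinarith [mul_le_mul_of_nonneg_right (hs t) (sub_nonneg.2 h2)]

/-- A sum with monotone nonnegative weights is at most twice the last weight times a bound for
the partial sums of the unweighted sequence. -/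
theorem abs_sum_mul_le {r a : ℕ → ℝ} {B : ℝ} (hr : Monotone r) (hr0 : 0 ≤ r 0) (t : ℕ)
    (ha : ∀ i ≤ t, |∑ k ∈ Finset.range i, a k| ≤ B) :
    |∑ k ∈ Finset.range t, r k * a k| ≤ 2 * r t * B := by
  have hB : 0 ≤ B := (abs_nonneg _).trans (ha 0 (by omega))
  -- The error of freezing the weight at its last value is at most B times the total variation r_i -
  -- r_0 of the weights.
  have key : ∀ i ≤ t, |∑ k ∈ Finset.range i, r k * a k - r i * ∑ k ∈ Finset.range i, a k|
      ≤ (r i - r 0) * B := by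
    intro i
    induction i with
    | zero => intro _; simp
    | succ i ih =>
      intro hi
      have h1 := ih (by omega)
      have h2 := ha (i + 1) hi
      have h3 := hr (Nat.le_succ i)
      have e : ∑ k ∈ Finset.range (i + 1), r k * a k - r (i + 1) * ∑ k ∈ Finset.range (i + 1), a k
          = (∑ k ∈ Finset.range i, r k * a k - r i * ∑ k ∈ Finset.range i, a k)
            - (r (i + 1) - r i) * ∑ k ∈ Finset.range (i + 1), a k := by
        simp only [Finset.sum_range_succ]; ring
      rw [e]
      refine (abs_sub _ _).trans ?_
      rw [abs_mul, abs_of_nonneg (sub_nonneg.2 h3)]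
      have := mul_le_mul_of_nonneg_left h2 (sub_nonneg.2 h3)
      simp only [Nat.succ_eq_add_one] at *
      linarith
  have h1 := key t le_rfl
  have h2 := ha t le_rfl
  have hrt : 0 ≤ r t := hr0.trans (hr (Nat.zero_le t))
  have e : ∑ k ∈ Finset.range t, r k * a k = (∑ k ∈ Finset.range t, r k * a k
      - r t * ∑ k ∈ Finset.range t, a k) + r t * ∑ k ∈ Finset.range t, a k := by ring
  rw [e]
  refine (abs_add_le _ _).trans ?_
  rw [abs_mul, abs_of_nonneg hrt]
  have := mul_le_mul_of_nonneg_left h2 hrt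
  nlinarith [mul_nonneg hr0 hB]

/-- If a positive monotone sequence at most doubles in each step, then some ratio
`∑_{i < t} s_i / s_t` is of order at least `T / log₊ (s_T / s_0)`. -/
theorem le_mul_logPlus_of_ratio_le {s : ℕ → ℝ} {R : ℝ} {T : ℕ} (hpos : ∀ t, 0 < s t)
    (hmono : ∀ t, s t ≤ s (t + 1)) (hgrow : ∀ t < T, s (t + 1) ≤ 2 * s t)
    (hR : ∀ t ≤ T, ∑ i ∈ Finset.range t, s i / s t ≤ R) :
    (T : ℝ) ≤ 2 * R * logPlus (s T / s 0) := by
  have hR0 : 0 ≤ R := by simpa using hR 0 (Nat.zero_le _)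
  -- Logarithmic potential: with ρ_t the ratio sum and q = s_{t+1}/s_t, one has ρ_{t+1} q = ρ_t + 1.
  -- Hence each unit of time is paid for by ρ_{t+1} - ρ_t or by ρ_{t+1}(q - 1) ≤ 2R log q, where q ≤
  -- 2 enters.
  have key : ∀ t ≤ T, (t : ℝ) ≤ ∑ i ∈ Finset.range t, s i / s t
      + 2 * R * (Real.log (s t) - Real.log (s 0)) := by
    intro t
    induction t with
    | zero => simp
    | succ t ih =>
      intro ht
      have h1 := ih (by omega)
      have h2 := hR (t + 1) ht
      set ρ := ∑ i ∈ Finset.range t, s i / s t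
      set ρ' := ∑ i ∈ Finset.range (t + 1), s i / s (t + 1)
      have hp := hpos t
      have hp' := hpos (t + 1)
      have hm := hmono t
      have hg := hgrow t (by omega)
      have hρ' : 0 ≤ ρ' := Finset.sum_nonneg fun i _ => (div_pos (hpos i) hp').le
      have hrec : ρ' * (s (t + 1) / s t) = ρ + 1 := by
        simp only [ρ, ρ', ← Finset.sum_div, Finset.sum_range_succ]
        field_simp
      have hlog : s (t + 1) / s t - 1 ≤ 2 * (Real.log (s (t + 1)) - Real.log (s t)) := by
        rw [← Real.log_div hp'.ne' hp.ne']
        have hq1 : 1 ≤ s (t + 1) / s t := by rw [le_div_iff₀ hp]; linarith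
        have hq2 : s (t + 1) / s t ≤ 2 := by rw [div_le_iff₀ hp]; linarith
        set q := s (t + 1) / s t
        have := Real.one_sub_inv_le_log_of_pos (show 0 < q by linarith)
        have h3 : (q - 1) / 2 ≤ 1 - q⁻¹ := by
          have hq : 0 < q := by linarith
          rw [show 1 - q⁻¹ = (q - 1) / q by field_simp]
          exact div_le_div_of_nonneg_left (by linarith) hq hq2
        linarith
      have hq1 : 0 ≤ s (t + 1) / s t - 1 := by
        rw [sub_nonneg, le_div_iff₀ hp]; linarith
      have : ρ' * (s (t + 1) / s t - 1) ≤ R * (2 * (Real.log (s (t + 1)) - Real.log (s t))) :=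
        mul_le_mul h2 hlog hq1 hR0
      push_cast
      nlinarith
  have h1 := key T le_rfl
  have h2 := hR T le_rfl
  unfold logPlus
  rw [Real.log_div (hpos T).ne' (hpos 0).ne']
  linarith

/-- `∑ a_k / √(a_0 + ⋯ + a_k) ≤ 2 √(∑ a_k)`, with possibly larger denominators. -/
theorem sum_div_le_two_mul_sqrt {a s : ℕ → ℝ} (ha : ∀ k, 0 ≤ a k) (t : ℕ)
    (hs : ∀ k < t, √(∑ i ∈ Finset.range (k + 1), a i) ≤ s k) :
    ∑ k ∈ Finset.range t, a k / s k ≤ 2 * √(∑ i ∈ Finset.range t, a i) := by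
  induction t with
  | zero => simp
  | succ t ih =>
    have h1 := ih fun k hk => hs k (by omega)
    have h2 := hs t (by omega)
    rw [Finset.sum_range_succ]
    rw [Finset.sum_range_succ] at h2 ⊢
    set A := ∑ i ∈ Finset.range t, a i
    have hA : 0 ≤ A := Finset.sum_nonneg fun i _ => ha i
    have hp := Real.sq_sqrt hA
    have hq := Real.sq_sqrt (add_nonneg hA (ha t))
    have hpq : √A ≤ √(A + a t) := Real.sqrt_le_sqrt (by linarith [ha t])
    have hp0 := Real.sqrt_nonneg A
    have : a t / s t ≤ 2 * (√(A + a t) - √A) := by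
      rcases (Real.sqrt_nonneg (A + a t)).eq_or_lt with h0 | h0
      · have : a t = 0 := by nlinarith [ha t]
        rw [this]; simp
      · rw [div_le_iff₀ (h0.trans_le h2)]
        nlinarith
    linarith

/-- The logarithmically damped sum of `a_k / (a_0 + ⋯ + a_k)` is bounded. -/
theorem sum_div_mul_logPlus_sq_le {a b c : ℕ → ℝ} {l : ℝ} (hl : 0 < l) (ha : ∀ k, 0 ≤ a k)
    (t : ℕ) (hb : ∀ k < t, l + ∑ i ∈ Finset.range (k + 1), a i ≤ b k)
    (hc : ∀ k < t, 1 + (∑ i ∈ Finset.range k, a i) / l ≤ c k)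
    (hc' : ∀ k < t, 1 + (∑ i ∈ Finset.range (k + 1), a i) / l ≤ 2 * c k) :
    ∑ k ∈ Finset.range t, a k / (logPlus (c k) ^ 2 * b k)
      ≤ 2 - 2 / logPlus (1 + (∑ i ∈ Finset.range t, a i) / l) := by
  induction t with
  | zero => simp [logPlus]
  | succ t ih =>
    have h1 := ih (fun k hk => hb k (by omega)) (fun k hk => hc k (by omega))
      (fun k hk => hc' k (by omega))
    have hb := hb t (by omega)
    have hc := hc t (by omega)
    have hc' := hc' t (by omega)
    rw [Finset.sum_range_succ (fun k => a k / (logPlus (c k) ^ 2 * b k))]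
    rw [Finset.sum_range_succ] at hb hc' ⊢
    set A := ∑ i ∈ Finset.range t, a i
    have hA : 0 ≤ A := Finset.sum_nonneg fun i _ => ha i
    have hat := ha t
    have hp1 : 1 ≤ 1 + A / l := by have : 0 ≤ A / l := by positivity
                                   linarith
    have hpq : 1 + A / l ≤ 1 + (A + a t) / l := by gcongr; linarith
    have hP := one_le_logPlus hp1
    have hPQ := logPlus_le_logPlus (by linarith) hpq
    have hPC := logPlus_le_logPlus (by linarith) hc
    have hQC : logPlus (1 + (A + a t) / l) ≤ 2 * logPlus (c t) := by
      have h3 := logPlus_le_logPlus (by linarith) hc'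
      have h4 : logPlus (2 * c t) = Real.log 2 + logPlus (c t) := by
        unfold logPlus; rw [Real.log_mul (by norm_num) (by linarith)]; ring
      have := Real.log_two_lt_d9
      linarith
    -- This is 1 - 1/u ≤ log u at the ratio u of consecutive arguments. The undamped sum would grow
    -- like a logarithm; dividing its increments q - p by C² ≥ pq/2 makes them telescope as 2/p -
    -- 2/q.
    have hdiff : a t / (l + (A + a t)) ≤ logPlus (1 + (A + a t) / l) - logPlus (1 + A / l) := by
      have h5 := Real.one_sub_inv_le_log_of_pos
        (show 0 < (1 + (A + a t) / l) / (1 + A / l) by positivity)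
      rw [Real.log_div (by positivity) (by positivity)] at h5
      unfold logPlus
      have : 1 - ((1 + (A + a t) / l) / (1 + A / l))⁻¹ = a t / (l + (A + a t)) := by
        field_simp; ring
      linarith
    set p := logPlus (1 + A / l)
    set q := logPlus (1 + (A + a t) / l)
    set C := logPlus (c t)
    have hb0 : 0 < l + (A + a t) := by positivity
    have hp0 : 0 < p := by linarith
    have hq0 : 0 < q := by linarith
    have hC0 : 0 < C := by linarith
    have : a t / (C ^ 2 * b t) ≤ 2 / p - 2 / q := by
      calc a t / (C ^ 2 * b t) ≤ a t / (C ^ 2 * (l + (A + a t))) := by gcongr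
        _ = (a t / (l + (A + a t))) / C ^ 2 := by field_simp
        _ ≤ (q - p) / C ^ 2 := by gcongr
        _ ≤ (q - p) / (p * (q / 2)) := by
            apply div_le_div_of_nonneg_left (by linarith) (by positivity)
            rw [sq]
            exact mul_le_mul hPC (by linarith) (by linarith) hC0.le
        _ = 2 / p - 2 / q := by
            field_simp
    linarith

/-! ### Self-normalized concentration -/

/-- Subtracting y² absorbs the second-order term of the exponential. The compensator is thus the
observed square rather than a conditional variance, which is what makes the resulting bound
empirical. -/
theorem exp_sub_sq_le {y : ℝ} (hy : |y| ≤ 1 / 2) : Real.exp (y - y ^ 2) ≤ 1 + y := by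
  obtain ⟨h1, h2⟩ := abs_le.1 hy
  rcases le_total 0 y with h0 | h0
  · have hu : |y - y ^ 2| ≤ 1 := by rw [abs_le]; constructor <;> nlinarith
    have := (abs_le.1 (Real.abs_exp_sub_one_sub_id_le hu)).2
    have h3 : (y - y ^ 2) ^ 2 ≤ y ^ 2 := by
      have : (1 - y) ^ 2 ≤ 1 := by nlinarith
      nlinarith [sq_nonneg y]
    linarith
  · have hv : 0 ≤ y ^ 2 - y := by nlinarith
    have hq := Real.quadratic_le_exp_of_nonneg hv
    have hpos : 0 < 1 + y := by linarith
    have key : 1 ≤ (1 + y) * (1 + (y ^ 2 - y) + (y ^ 2 - y) ^ 2 / 2) := by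
      have h4 : 0 ≤ (1 - y) ^ 2 * (1 + y) + 2 * y := by nlinarith [sq_nonneg y]
      nlinarith [mul_nonneg (sq_nonneg y) h4]
    have h5 : 1 ≤ (1 + y) * Real.exp (y ^ 2 - y) :=
      key.trans (mul_le_mul_of_nonneg_left hq hpos.le)
    have e : Real.exp (y - y ^ 2) * Real.exp (y ^ 2 - y) = 1 := by
      rw [← Real.exp_add]; simp
    have hp := Real.exp_pos (y ^ 2 - y)
    by_contra! hc
    nlinarith

section Concentration

variable {Ω : Type*} {m : MeasurableSpace Ω} {μ : Measure Ω}

/-- Multiplying by `exp (Y - 𝔼[Y | m₀] - Y²)` does not increase integrals over events of the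
past, when `|Y| ≤ 1 / 2`. -/
theorem setIntegral_mul_exp_le [IsProbabilityMeasure μ] {m₀ : MeasurableSpace Ω} (hm : m₀ ≤ m)
    {M Y : Ω → ℝ} {K : ℝ} (hM : StronglyMeasurable[m₀] M) (hM0 : ∀ ω, 0 ≤ M ω)
    (hMK : ∀ᵐ ω ∂μ, M ω ≤ K) (hY : AEStronglyMeasurable[m] Y μ)
    (hY' : ∀ᵐ ω ∂μ, |Y ω| ≤ 1 / 2) {S : Set Ω} (hS : MeasurableSet[m₀] S) :
    ∫ ω in S, M ω * Real.exp (Y ω - (μ[Y | m₀]) ω - Y ω ^ 2) ∂μ ≤ ∫ ω in S, M ω ∂μ := by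
  have hYi : Integrable Y μ := Integrable.of_bound hY (1 / 2) (by simpa using hY')
  have hc : ∀ᵐ ω ∂μ, |(μ[Y | m₀]) ω| ≤ 1 / 2 :=
    ae_bdd_abs_condExp_of_ae_bdd_abs hY'
  have hcm : StronglyMeasurable[m₀] (μ[Y | m₀]) := stronglyMeasurable_condExp
  have hWm : StronglyMeasurable[m₀] fun ω => M ω * Real.exp (-(μ[Y | m₀]) ω) :=
    hM.mul (Real.continuous_exp.comp_stronglyMeasurable hcm.neg)
  have hexp : ∀ᵐ ω ∂μ, Real.exp (-(μ[Y | m₀]) ω) ≤ Real.exp 1 := by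
    filter_upwards [hc] with ω h
    exact Real.exp_le_exp.2 (by linarith [(abs_le.1 h).1])
  have hWK : ∀ᵐ ω ∂μ, M ω * Real.exp (-(μ[Y | m₀]) ω) ≤ K * Real.exp 1 := by
    filter_upwards [hexp, hMK] with ω h h'
    have := hM0 ω
    gcongr
    linarith
  have hW0 : ∀ ω, 0 ≤ M ω * Real.exp (-(μ[Y | m₀]) ω) := fun ω =>
    mul_nonneg (hM0 ω) (Real.exp_pos _).le
  have hWi : Integrable (fun ω => M ω * Real.exp (-(μ[Y | m₀]) ω)) μ := by
    refine Integrable.of_bound (hWm.mono hm).aestronglyMeasurable (K * Real.exp 1) ?_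
    filter_upwards [hWK] with ω h
    rwa [Real.norm_of_nonneg (hW0 ω)]
  have hWY : Integrable (fun ω => M ω * Real.exp (-(μ[Y | m₀]) ω) * Y ω) μ := by
    refine hWi.mul_bdd (c := 1 / 2) hY (by simpa using hY')
  have hWc : Integrable (fun ω => M ω * Real.exp (-(μ[Y | m₀]) ω) * (μ[Y | m₀]) ω) μ := by
    refine hWi.mul_bdd (c := 1 / 2) (hcm.mono hm).aestronglyMeasurable (by simpa using hc)
  have hMi : Integrable M μ := by
    refine Integrable.of_bound (hM.mono hm).aestronglyMeasurable K ?_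
    filter_upwards [hMK] with ω h
    rwa [Real.norm_of_nonneg (hM0 ω)]
  -- The factor M exp(-𝔼[Y | m₀]) is m₀-measurable, so Y may be replaced by its conditional mean c;
  -- then (1 + c) e^{-c} ≤ 1 finishes.
  have hswap : ∫ ω in S, M ω * Real.exp (-(μ[Y | m₀]) ω) * Y ω ∂μ
      = ∫ ω in S, M ω * Real.exp (-(μ[Y | m₀]) ω) * (μ[Y | m₀]) ω ∂μ := by
    rw [← setIntegral_condExp hm hWY hS]
    refine setIntegral_congr_ae (hm _ hS) ?_
    filter_upwards [condExp_mul_of_stronglyMeasurable_left hWm hWY hYi] with ω h _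
    exact h
  calc ∫ ω in S, M ω * Real.exp (Y ω - (μ[Y | m₀]) ω - Y ω ^ 2) ∂μ
      ≤ ∫ ω in S, (M ω * Real.exp (-(μ[Y | m₀]) ω)
          + M ω * Real.exp (-(μ[Y | m₀]) ω) * Y ω) ∂μ := by
        refine integral_mono_of_nonneg (.of_forall fun ω => mul_nonneg (hM0 ω) (Real.exp_pos _).le)
          (hWi.add hWY).integrableOn (ae_restrict_of_ae ?_)
        filter_upwards [hY'] with ω h
        have h1 := exp_sub_sq_le h
        have e : Real.exp (Y ω - (μ[Y | m₀]) ω - Y ω ^ 2)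
            = Real.exp (-(μ[Y | m₀]) ω) * Real.exp (Y ω - Y ω ^ 2) := by
          rw [← Real.exp_add]; ring_nf
        rw [e]
        have := mul_le_mul_of_nonneg_left h1 (hW0 ω)
        linarith
    _ = ∫ ω in S, (M ω * Real.exp (-(μ[Y | m₀]) ω)
          + M ω * Real.exp (-(μ[Y | m₀]) ω) * (μ[Y | m₀]) ω) ∂μ := by
        rw [integral_add hWi.integrableOn hWY.integrableOn, hswap,
          integral_add hWi.integrableOn hWc.integrableOn]
    _ ≤ ∫ ω in S, M ω ∂μ := by
        refine integral_mono (hWi.add hWc).integrableOn hMi.integrableOn fun ω => ?_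
        have h1 := Real.add_one_le_exp ((μ[Y | m₀]) ω)
        have e : Real.exp (-(μ[Y | m₀]) ω) * Real.exp ((μ[Y | m₀]) ω) = 1 := by
          rw [← Real.exp_add]; simp
        have := mul_le_mul_of_nonneg_left h1 (hW0 ω)
        rw [mul_assoc (M ω) _ (Real.exp _), e] at this
        simp only
        linarith

/-- A time-uniform self-normalized concentration inequality for adapted processes with increments
bounded by `1 / 2`. -/
theorem measure_exists_le_sum_le [IsProbabilityMeasure μ] {ℱ : Filtration ℕ m} {T : ℕ}
    {Y : ℕ → Ω → ℝ} (hY : ∀ k < T, StronglyMeasurable[ℱ (k + 1)] (Y k))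
    (hb : ∀ k < T, ∀ᵐ ω ∂μ, |Y k ω| ≤ 1 / 2) (a : ℝ) :
    μ {ω | ∃ t ≤ T, a ≤ ∑ k ∈ Finset.range t, (Y k ω - (μ[Y k | ℱ k]) ω - Y k ω ^ 2)}
      ≤ ENNReal.ofReal (Real.exp (-a)) := by
  set Z : ℕ → Ω → ℝ := fun t ω =>
    ∑ k ∈ Finset.range t, (Y k ω - (μ[Y k | ℱ k]) ω - Y k ω ^ 2) with hZ
  set B : ℕ → Set Ω := fun t => {ω | ∃ s ≤ t, a ≤ Z s ω} with hB
  have hZm : ∀ t ≤ T, StronglyMeasurable[ℱ t] (Z t) := by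
    intro t ht
    refine Finset.stronglyMeasurable_fun_sum _ fun k hk => ?_
    have hk : k < t := Finset.mem_range.1 hk
    have h1 : StronglyMeasurable[ℱ t] (Y k) := (hY k (by omega)).mono (ℱ.mono hk)
    have h2 : StronglyMeasurable[ℱ t] (μ[Y k | ℱ k]) :=
      stronglyMeasurable_condExp.mono (ℱ.mono hk.le)
    exact (h1.sub h2).sub (h1.pow 2)
  have hBm : ∀ t ≤ T, MeasurableSet[ℱ t] (B t) := by
    intro t ht
    have : B t = ⋃ s ∈ Finset.range (t + 1), {ω | a ≤ Z s ω} := by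
      ext ω; simp [hB]
    rw [this]
    refine Finset.measurableSet_biUnion _ fun s hs => ?_
    have hs : s ≤ t := Nat.lt_succ_iff.1 (Finset.mem_range.1 hs)
    exact ℱ.mono hs _ (measurableSet_le measurable_const (hZm s (hs.trans ht)).measurable)
  have hZb : ∀ t ≤ T, ∀ᵐ ω ∂μ, Real.exp (Z t ω) ≤ Real.exp t := by
    intro t ht
    have : ∀ k ∈ Finset.range t, ∀ᵐ ω ∂μ, Y k ω - (μ[Y k | ℱ k]) ω - Y k ω ^ 2 ≤ 1 := by
      intro k hk
      have hk : k < t := Finset.mem_range.1 hk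
      have h1 := hb k (by omega)
      have h2 : ∀ᵐ ω ∂μ, |(μ[Y k | ℱ k]) ω| ≤ 1 / 2 :=
        ae_bdd_abs_condExp_of_ae_bdd_abs h1
      filter_upwards [h1, h2] with ω h1 h2
      have := (abs_le.1 h1).2
      have := (abs_le.1 h2).1
      nlinarith [sq_nonneg (Y k ω)]
    rw [← Finset.eventually_all] at this
    filter_upwards [this] with ω h
    refine Real.exp_le_exp.2 ((Finset.sum_le_sum h).trans ?_)
    simp
  have hMi : ∀ t ≤ T, Integrable (fun ω => Real.exp (Z t ω)) μ := by
    intro t ht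
    refine Integrable.of_bound (Real.continuous_exp.comp_stronglyMeasurable
      ((hZm t ht).mono (ℱ.le t))).aestronglyMeasurable (Real.exp t) ?_
    filter_upwards [hZb t ht] with ω h
    rwa [Real.norm_of_nonneg (Real.exp_pos _).le]
  -- Ville's inequality by induction: paths that have not yet crossed carry their exponential mass,
  -- and those that have crossed are frozen at e^a.
  have key : ∀ t ≤ T, ∫ ω in (B t)ᶜ, Real.exp (Z t ω) ∂μ + Real.exp a * μ.real (B t) ≤ 1 := by
    intro t
    induction t with
    | zero =>
      intro _
      have hZ0 : ∀ ω, Z 0 ω = 0 := fun ω => by simp [hZ]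
      have hm0 := ℱ.le 0 _ (hBm 0 (Nat.zero_le _))
      simp only [hZ0, Real.exp_zero, setIntegral_const, smul_eq_mul, mul_one]
      have h1 := measureReal_add_measureReal_compl (μ := μ) hm0
      simp only [probReal_univ] at h1
      by_cases ha : a ≤ 0
      · have : Real.exp a ≤ 1 := Real.exp_le_one_iff.2 ha
        nlinarith [measureReal_nonneg (μ := μ) (s := B 0)]
      · have : B 0 = ∅ := by
          ext ω; simp [hB, hZ0]; linarith
        simp [this]
    | succ t ih =>
      intro ht
      have h1 := ih (by omega)
      have ht' : t ≤ T := by omega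
      have hmt := ℱ.le t _ (hBm t ht')
      have hmt' := ℱ.le (t + 1) _ (hBm (t + 1) ht)
      have hsub : B t ⊆ B (t + 1) := fun ω ⟨s, hs, h⟩ => ⟨s, by omega, h⟩
      have hstep : ∫ ω in (B t)ᶜ, Real.exp (Z (t + 1) ω) ∂μ ≤ ∫ ω in (B t)ᶜ, Real.exp (Z t ω) ∂μ := by
        have := setIntegral_mul_exp_le (ℱ.le t)
          (Real.continuous_exp.comp_stronglyMeasurable (hZm t ht')) (fun ω => (Real.exp_pos _).le)
          (hZb t ht') ((hY t (by omega)).mono (ℱ.le (t + 1))).aestronglyMeasurable (hb t (by omega))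
          (hBm t ht').compl
        simpa only [hZ, Finset.sum_range_succ, Real.exp_add] using this
      have hsplit : ∫ ω in (B t)ᶜ, Real.exp (Z (t + 1) ω) ∂μ
          = ∫ ω in (B (t + 1))ᶜ, Real.exp (Z (t + 1) ω) ∂μ
            + ∫ ω in B (t + 1) \ B t, Real.exp (Z (t + 1) ω) ∂μ := by
        rw [← setIntegral_union _ (hmt'.diff hmt) (hMi _ ht).integrableOn (hMi _ ht).integrableOn]
        · congr 2
          ext ω
          have := @hsub ω
          simp only [Set.mem_compl_iff, Set.mem_union, Set.mem_sdiff]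
          tauto
        · exact Set.disjoint_left.2 fun ω h h' => h h'.1
      -- A path in the difference first crosses exactly at time t + 1, so its exponential is at
      -- least e^a there.
      have hlow : Real.exp a * μ.real (B (t + 1) \ B t)
          ≤ ∫ ω in B (t + 1) \ B t, Real.exp (Z (t + 1) ω) ∂μ := by
        have := setIntegral_mono_on (μ := μ) (s := B (t + 1) \ B t) (f := fun _ => Real.exp a)
          (integrableOn_const (measure_ne_top _ _)) (hMi _ ht).integrableOn (hmt'.diff hmt)
          (fun ω ⟨⟨s, hs, h⟩, h'⟩ => by
            rcases Nat.lt_or_ge s (t + 1) with h2 | h2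
            · exact absurd ⟨s, by omega, h⟩ h'
            · have : s = t + 1 := by omega
              subst this
              exact Real.exp_le_exp.2 h)
        simpa [mul_comm] using this
      have hreal : μ.real (B (t + 1) \ B t) = μ.real (B (t + 1)) - μ.real (B t) :=
        measureReal_sdiff hsub hmt
      rw [hreal] at hlow
      linarith
  have h1 := key T le_rfl
  have h2 : 0 ≤ ∫ ω in (B T)ᶜ, Real.exp (Z T ω) ∂μ :=
    integral_nonneg fun ω => (Real.exp_pos _).le
  have h3 : μ.real (B T) ≤ Real.exp (-a) := by
    rw [Real.exp_neg, ← one_div, le_div_iff₀ (Real.exp_pos a)]; linarith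
  rw [← ofReal_measureReal (μ := μ) (s := B T)]
  exact ENNReal.ofReal_le_ofReal h3

/-- The self-normalized inequality for a vector-valued process tested against predictable
directions. -/
theorem measure_exists_le_sum_inner_le [IsProbabilityMeasure μ] {E : Type*} [NormedAddCommGroup E]
    [InnerProductSpace ℝ E] [CompleteSpace E] {ℱ : Filtration ℕ m} {T : ℕ} {g w : ℕ → Ω → E}
    (hg : ∀ k < T, StronglyMeasurable[ℱ (k + 1)] (g k)) (hgi : ∀ k < T, Integrable (g k) μ)
    (hw : ∀ k < T, StronglyMeasurable[ℱ k] (w k))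
    (hb : ∀ k < T, ∀ᵐ ω ∂μ, |inner ℝ (g k ω) (w k ω)| ≤ 1 / 2) {p : ℝ} (hp : 0 < p) :
    ∃ N : Set Ω, μ N ≤ ENNReal.ofReal p ∧ ∀ ω ∉ N, ∀ t ≤ T,
      ∑ k ∈ Finset.range t, inner ℝ (g k ω - (μ[g k | ℱ k]) ω) (w k ω)
        ≤ Real.log (1 / p) + ∑ k ∈ Finset.range t, inner ℝ (g k ω) (w k ω) ^ 2 := by
  have hm : ∀ k < T, StronglyMeasurable[ℱ (k + 1)] fun ω => (inner ℝ (g k ω) (w k ω) : ℝ) :=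
    fun k hk => (hg k hk).inner ((hw k hk).mono (ℱ.mono (Nat.le_succ k)))
  have hce : ∀ k < T, ∀ᵐ ω ∂μ, (μ[fun ω => (inner ℝ (g k ω) (w k ω) : ℝ) | ℱ k]) ω
      = inner ℝ ((μ[g k | ℱ k]) ω) (w k ω) := fun k hk =>
    condExp_bilin_of_stronglyMeasurable_right (innerSL ℝ) (hw k hk)
      (Integrable.of_bound ((hm k hk).mono (ℱ.le _)).aestronglyMeasurable (1 / 2)
        (hb k hk)) (hgi k hk)
  have hce' : ∀ᵐ ω ∂μ, ∀ k ∈ Finset.range T, (μ[fun ω => (inner ℝ (g k ω) (w k ω) : ℝ) | ℱ k]) ω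
      = inner ℝ ((μ[g k | ℱ k]) ω) (w k ω) := by
    rw [Finset.eventually_all]
    exact fun k hk => hce k (Finset.mem_range.1 hk)
  have hmain := measure_exists_le_sum_le hm hb (Real.log (1 / p))
  rw [one_div, Real.log_inv, neg_neg, Real.exp_log hp] at hmain
  -- The exceptional set joins the crossing event to the null set where the conditional mean of the
  -- inner product differs from the inner product with the conditional mean.
  refine ⟨_ ∪ _, (measure_union_le _ _).trans (add_le_add hmain (ae_iff.1 hce').le) |>.trans
    (by simp), fun ω hω t ht => ?_⟩
  simp only [Set.mem_union, Set.mem_ofPred_eq, not_or, not_not, not_exists, not_and, not_le] at hω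
  have h1 := hω.1 t ht
  have h2 : ∑ k ∈ Finset.range t, ((inner ℝ (g k ω) (w k ω) : ℝ)
      - (μ[fun ω => (inner ℝ (g k ω) (w k ω) : ℝ) | ℱ k]) ω - inner ℝ (g k ω) (w k ω) ^ 2)
      = ∑ k ∈ Finset.range t, inner ℝ (g k ω - (μ[g k | ℱ k]) ω) (w k ω)
        - ∑ k ∈ Finset.range t, inner ℝ (g k ω) (w k ω) ^ 2 := by
    rw [← Finset.sum_sub_distrib]
    refine Finset.sum_congr rfl fun k hk => ?_
    rw [hω.2 k (Finset.mem_range.2 ((Finset.mem_range.1 hk).trans_le ht)), inner_sub_left]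
  rw [h2] at h1
  rw [one_div, Real.log_inv]
  linarith

end Concentration

/-! ### Euclidean projection -/

section Projection

variable {n : ℕ} {X : Set (EuclideanSpace ℝ (Fin n))}

theorem inner_euclideanProj_nonpos (hX : IsClosed X) (hc : Convex ℝ X) (hne : X.Nonempty)
    (y : EuclideanSpace ℝ (Fin n)) {q : EuclideanSpace ℝ (Fin n)} (hq : q ∈ X) :
    inner ℝ (y - euclideanProj X y) (q - euclideanProj X y) ≤ 0 := by
  obtain ⟨hp, hmin⟩ := euclideanProj_spec hX hne y
  refine (norm_eq_iInf_iff_real_inner_le_zero hc hp).1 ?_ q hq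
  have : Nonempty X := hne.to_subtype
  refine le_antisymm (le_ciInf fun w => hmin w w.2) ?_
  exact ciInf_le ⟨0, by rintro _ ⟨w, rfl⟩; exact norm_nonneg _⟩ (⟨_, hp⟩ : X)

theorem norm_euclideanProj_sub_le (hX : IsClosed X) (hc : Convex ℝ X) (hne : X.Nonempty)
    (y : EuclideanSpace ℝ (Fin n)) {q : EuclideanSpace ℝ (Fin n)} (hq : q ∈ X) :
    ‖euclideanProj X y - q‖ ≤ ‖y - q‖ := by
  have h := inner_euclideanProj_nonpos hX hc hne y hq
  set p := euclideanProj X y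
  have e : ‖y - q‖ ^ 2 = ‖y - p‖ ^ 2 - 2 * inner ℝ (y - p) (q - p) + ‖q - p‖ ^ 2 := by
    rw [← norm_sub_sq_real]; congr 2; abel
  rw [norm_sub_rev p q]
  refine (sq_le_sq₀ (norm_nonneg _) (norm_nonneg _)).1 ?_
  nlinarith [sq_nonneg ‖y - p‖]

/-- Needed for measurability: continuity of the projection keeps the iterates adapted. -/
theorem lipschitzWith_euclideanProj (hX : IsClosed X) (hc : Convex ℝ X) (hne : X.Nonempty) :
    LipschitzWith 1 (euclideanProj X) := by
  refine LipschitzWith.of_dist_le_mul fun y z => ?_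
  rw [NNReal.coe_one, one_mul, dist_eq_norm, dist_eq_norm]
  have h1 := inner_euclideanProj_nonpos hX hc hne y (euclideanProj_spec hX hne z).1
  have h2 := inner_euclideanProj_nonpos hX hc hne z (euclideanProj_spec hX hne y).1
  set p := euclideanProj X y
  set q := euclideanProj X z
  have e : inner ℝ (y - p) (q - p) + inner ℝ (z - q) (p - q)
      = ‖p - q‖ ^ 2 - inner ℝ (y - z) (p - q) := by
    rw [← real_inner_self_eq_norm_sq, ← neg_sub p q, inner_neg_right, ← sub_eq_neg_add,
      ← inner_sub_left, ← inner_sub_left]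
    congr 1; abel
  have h3 := real_inner_le_norm (y - z) (p - q)
  rcases (norm_nonneg (p - q)).eq_or_lt with h0 | h0
  · rw [← h0]; exact norm_nonneg _
  · refine le_of_mul_le_mul_right ?_ h0
    nlinarith

end Projection

/-! ### Step sizes and basic inequalities along one run -/

section Run

variable {n : ℕ} {X : Set (EuclideanSpace ℝ (Fin n))} {ℓ : EuclideanSpace ℝ (Fin n) → ℝ}
  {x₀ : EuclideanSpace ℝ (Fin n)} {rε δ : ℝ} {T : ℕ} {x g : ℕ → EuclideanSpace ℝ (Fin n)}

theorem le_rbar (rε : ℝ) (x : ℕ → EuclideanSpace ℝ (Fin n)) (t : ℕ) : rε ≤ rbar rε x t :=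
  le_max_right _ _

theorem norm_sub_le_rbar {k t : ℕ} (h : k ≤ t) : ‖x k - x 0‖ ≤ rbar rε x t :=
  (Finset.le_sup' (fun k => ‖x k - x 0‖) (Finset.mem_range.2 (Nat.lt_succ_of_le h))).trans
    (le_max_left _ _)

theorem rbar_le_iff {t : ℕ} {r : ℝ} :
    rbar rε x t ≤ r ↔ (∀ k ≤ t, ‖x k - x 0‖ ≤ r) ∧ rε ≤ r := by
  simp [rbar, Finset.sup'_le_iff]

theorem rbar_monotone : Monotone (rbar rε x) := fun _ t hst =>
  rbar_le_iff.2 ⟨fun _ hk => norm_sub_le_rbar (hk.trans hst), le_rbar rε x t⟩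

theorem rbar_zero (h : 0 ≤ rε) : rbar rε x 0 = rε := by
  refine le_antisymm (rbar_le_iff.2 ⟨fun k hk => ?_, le_rfl⟩) (le_rbar rε x 0)
  rw [Nat.le_zero.1 hk]; simpa using h

theorem le_lbar {k t : ℕ} (h : k ≤ t) : ℓ (x k) ≤ lbar ℓ x t :=
  Finset.le_sup' (fun k => ℓ (x k)) (Finset.mem_range.2 (Nat.lt_succ_of_le h))

theorem lbar_le_iff {t : ℕ} {r : ℝ} : lbar ℓ x t ≤ r ↔ ∀ k ≤ t, ℓ (x k) ≤ r := by
  simp [lbar, Finset.sup'_le_iff]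

theorem lbar_monotone : Monotone (lbar ℓ x) := fun _ _ hst =>
  lbar_le_iff.2 fun _ hk => le_lbar (hk.trans hst)

theorem lbar_zero : lbar ℓ x 0 = ℓ (x 0) := by simp [lbar]

theorem gradSqSumPred_nonneg (t : ℕ) : 0 ≤ gradSqSumPred g t :=
  Finset.sum_nonneg fun _ _ => sq_nonneg _

theorem gradSqSumPred_monotone : Monotone (gradSqSumPred g) :=
  monotone_nat_of_le_succ fun t => by
    unfold gradSqSumPred
    rw [Finset.sum_range_succ]
    linarith [sq_nonneg ‖g t‖]

theorem gradSqSumPred_le {t : ℕ} {L : ℝ} (h : ∀ k < t, ‖g k‖ ≤ L) :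
    gradSqSumPred g t ≤ t * L ^ 2 := by
  have : ∀ k ∈ Finset.range t, ‖g k‖ ^ 2 ≤ L ^ 2 := fun k hk =>
    pow_le_pow_left₀ (norm_nonneg _) (h k (Finset.mem_range.1 hk)) 2
  exact (Finset.sum_le_sum this).trans (by simp)

theorem lbar_pos (h0 : 0 < ℓ (x 0)) (t : ℕ) : 0 < lbar ℓ x t :=
  h0.trans_le (le_lbar (Nat.zero_le t))

theorem one_le_log_term (t : ℕ) :
    1 ≤ logPlus (1 + (t : ℝ) * lbar ℓ x t ^ 2 / lbar ℓ x 0 ^ 2) := by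
  refine one_le_logPlus ?_
  have : 0 ≤ (t : ℝ) * lbar ℓ x t ^ 2 / lbar ℓ x 0 ^ 2 := by positivity
  linarith

theorem sqrt_tdogG (hθ : 0 ≤ theta T δ) (t : ℕ) :
    √(tdogG ℓ T δ x g t) = 64 * theta T δ
      * logPlus (1 + (t : ℝ) * lbar ℓ x t ^ 2 / lbar ℓ x 0 ^ 2)
      * √(gradSqSumPred g t + 16 * lbar ℓ x t ^ 2) := by
  have h1 := one_le_log_term (ℓ := ℓ) (x := x) t
  have e : tdogG ℓ T δ x g t = (64 * theta T δ
      * logPlus (1 + (t : ℝ) * lbar ℓ x t ^ 2 / lbar ℓ x 0 ^ 2)) ^ 2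
        * (gradSqSumPred g t + 16 * lbar ℓ x t ^ 2) := by
    unfold tdogG; ring
  rw [e, Real.sqrt_mul (sq_nonneg _), Real.sqrt_sq (by positivity)]

theorem mul_sqrt_le_sqrt_tdogG (hθ : 0 ≤ theta T δ) (t : ℕ) :
    64 * theta T δ * √(gradSqSumPred g t + 16 * lbar ℓ x t ^ 2) ≤ √(tdogG ℓ T δ x g t) := by
  rw [sqrt_tdogG hθ]
  have h1 := one_le_log_term (ℓ := ℓ) (x := x) t
  have : 64 * theta T δ * 1 ≤ 64 * theta T δ *
      logPlus (1 + (t : ℝ) * lbar ℓ x t ^ 2 / lbar ℓ x 0 ^ 2) := by gcongr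
  rw [mul_one] at this
  gcongr

/-- The term 16 ℓ̄² alone contributes 4 ℓ̄ under the root, and 64 · 4 = 256. This bounds the current
gradient, which G_{t-1} does not yet contain. -/
theorem mul_lbar_le_sqrt_tdogG (hθ : 0 ≤ theta T δ) (t : ℕ) :
    256 * theta T δ * lbar ℓ x t ≤ √(tdogG ℓ T δ x g t) := by
  refine le_trans ?_ (mul_sqrt_le_sqrt_tdogG hθ t)
  have : 4 * lbar ℓ x t ≤ √(gradSqSumPred g t + 16 * lbar ℓ x t ^ 2) := by
    refine Real.le_sqrt_of_sq_le ?_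
    have := gradSqSumPred_nonneg (g := g) t
    nlinarith
  nlinarith [mul_le_mul_of_nonneg_left this hθ]

theorem sqrt_tdogG_pos (hθ : 0 < theta T δ) (h0 : 0 < ℓ (x 0)) (t : ℕ) :
    0 < √(tdogG ℓ T δ x g t) :=
  lt_of_lt_of_le (by have := lbar_pos h0 t; positivity) (mul_lbar_le_sqrt_tdogG hθ.le t)

theorem sqrt_tdogG_mono (hθ : 0 ≤ theta T δ) (h0 : 0 < ℓ (x 0)) {s t : ℕ} (hst : s ≤ t) :
    √(tdogG ℓ T δ x g s) ≤ √(tdogG ℓ T δ x g t) := by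
  have h1 := one_le_log_term (ℓ := ℓ) (x := x) s
  have hl := lbar_pos h0 s
  have hl0 := lbar_pos h0 0
  have hm := lbar_monotone (ℓ := ℓ) (x := x) hst
  have hG := gradSqSumPred_monotone (g := g) hst
  have hst' : (s : ℝ) ≤ t := by exact_mod_cast hst
  rw [sqrt_tdogG hθ, sqrt_tdogG hθ]
  have : logPlus (1 + (s : ℝ) * lbar ℓ x s ^ 2 / lbar ℓ x 0 ^ 2)
      ≤ logPlus (1 + (t : ℝ) * lbar ℓ x t ^ 2 / lbar ℓ x 0 ^ 2) :=
    logPlus_le_logPlus (by positivity) (by gcongr)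
  have h2 : 0 ≤ logPlus (1 + (t : ℝ) * lbar ℓ x t ^ 2 / lbar ℓ x 0 ^ 2) := by linarith
  gcongr

theorem tdogStep_mul_norm_le (hrε : 0 < rε) (hθ : 0 < theta T δ) (h0 : 0 < ℓ (x 0)) {t : ℕ}
    (hg : ‖g t‖ ≤ ℓ (x t)) :
    tdogStep ℓ rε T δ x g t * ‖g t‖ ≤ rbar rε x t / (256 * theta T δ) := by
  have hs := sqrt_tdogG_pos (g := g) hθ h0 t
  have h1 := mul_lbar_le_sqrt_tdogG (ℓ := ℓ) (x := x) (g := g) hθ.le t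
  have h2 : ‖g t‖ ≤ lbar ℓ x t := hg.trans (le_lbar le_rfl)
  have hr : 0 < rbar rε x t := hrε.trans_le (le_rbar rε x t)
  unfold tdogStep
  rw [div_mul_eq_mul_div, div_le_div_iff₀ hs (by positivity), mul_assoc]
  gcongr
  nlinarith

theorem IsTDoGRun.mem (h : IsTDoGRun X ℓ x₀ rε T δ x g) (hX : IsClosed X) (h₀ : x₀ ∈ X) {t : ℕ}
    (ht : t ≤ T) : x t ∈ X := by
  cases t with
  | zero => rw [h.init]; exact h₀
  | succ t => rw [h.step t ht]; exact (euclideanProj_spec hX ⟨x₀, h₀⟩ _).1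

/-- A step has length at most r̄_t / (256 θ) ≤ r̄_t. Doubling is all that the best-index argument
needs. -/
theorem IsTDoGRun.rbar_succ_le (h : IsTDoGRun X ℓ x₀ rε T δ x g) (hX : IsClosed X)
    (hc : Convex ℝ X) (h₀ : x₀ ∈ X) (hrε : 0 < rε) (hθ : 1 ≤ theta T δ) (hl : 0 < ℓ (x 0))
    {t : ℕ} (ht : t < T) (hg : ‖g t‖ ≤ ℓ (x t)) : rbar rε x (t + 1) ≤ 2 * rbar rε x t := by
  have hr : 0 < rbar rε x t := hrε.trans_le (le_rbar rε x t)
  have hs := sqrt_tdogG_pos (g := g) (by linarith : 0 < theta T δ) hl t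
  have hη : 0 ≤ tdogStep ℓ rε T δ x g t := (div_pos hr hs).le
  have hstep : ‖x (t + 1) - x t‖ ≤ rbar rε x t := by
    rw [h.step t ht]
    refine (norm_euclideanProj_sub_le hX hc ⟨x₀, h₀⟩ _ (h.mem hX h₀ ht.le)).trans ?_
    rw [sub_sub_cancel_left, norm_neg, norm_smul, Real.norm_of_nonneg hη]
    refine (tdogStep_mul_norm_le hrε (by linarith) hl hg).trans (div_le_self hr.le ?_)
    linarith
  refine rbar_le_iff.2 ⟨fun k hk => ?_, by linarith [le_rbar rε x t]⟩
  rcases Nat.lt_or_ge k (t + 1) with hk' | hk'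
  · linarith [norm_sub_le_rbar (rε := rε) (x := x) (Nat.lt_succ_iff.1 hk')]
  · rw [show k = t + 1 by omega]
    have := norm_sub_le_norm_sub_add_norm_sub (x (t + 1)) (x t) (x 0)
    linarith [norm_sub_le_rbar (rε := rε) (x := x) (le_refl t)]

/-- The basic inequality of projected subgradient steps. -/
theorem IsTDoGRun.two_mul_inner_le (h : IsTDoGRun X ℓ x₀ rε T δ x g) (hX : IsClosed X)
    (hc : Convex ℝ X) (h₀ : x₀ ∈ X) {y : EuclideanSpace ℝ (Fin n)} (hy : y ∈ X) {t : ℕ}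
    (ht : t < T) :
    2 * (tdogStep ℓ rε T δ x g t * inner ℝ (g t) (x t - y)) ≤
      ‖x t - y‖ ^ 2 - ‖x (t + 1) - y‖ ^ 2 + tdogStep ℓ rε T δ x g t ^ 2 * ‖g t‖ ^ 2 := by
  set η := tdogStep ℓ rε T δ x g t with hη
  have h1 : ‖x (t + 1) - y‖ ≤ ‖x t - η • g t - y‖ := by
    rw [h.step t ht]
    exact norm_euclideanProj_sub_le hX hc ⟨x₀, h₀⟩ _ hy
  have h2 : ‖x t - η • g t - y‖ ^ 2
      = ‖x t - y‖ ^ 2 - 2 * (η * inner ℝ (g t) (x t - y)) + η ^ 2 * ‖g t‖ ^ 2 := by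
    rw [sub_right_comm, norm_sub_sq_real, inner_smul_right, norm_smul, mul_pow,
      Real.norm_eq_abs, sq_abs, real_inner_comm]
  have h3 := pow_le_pow_left₀ (norm_nonneg _) h1 2
  linarith

/-- The squared logarithm in G' makes this sum bounded uniformly in t; `sum_div_mul_logPlus_sq_le`
applies with l = ℓ̄_0², and 16 ℓ̄_k² leaves room for both l and the current ‖g_k‖². -/
theorem sum_norm_sq_div_tdogG_le (hl : 0 < ℓ (x 0)) {t : ℕ} (hg : ∀ k < t, ‖g k‖ ≤ ℓ (x k)) :
    ∑ k ∈ Finset.range t, ‖g k‖ ^ 2 / tdogG ℓ T δ x g k ≤ 2 / (8 ^ 4 * theta T δ ^ 2) := by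
  have hl0 : 0 < lbar ℓ x 0 := lbar_pos hl 0
  have hG : ∀ k ≤ t, gradSqSumPred g k ≤ k * lbar ℓ x k ^ 2 := fun k hk =>
    gradSqSumPred_le fun i hi => (hg i (by omega)).trans (le_lbar hi.le)
  have hG' : ∀ k < t, gradSqSumPred g (k + 1) ≤ gradSqSumPred g k + lbar ℓ x k ^ 2 := by
    intro k hk
    unfold gradSqSumPred
    rw [Finset.sum_range_succ]
    have := pow_le_pow_left₀ (norm_nonneg _) ((hg k hk).trans (le_lbar le_rfl)) 2
    linarith
  have hlm : ∀ k, lbar ℓ x 0 ^ 2 ≤ lbar ℓ x k ^ 2 := fun k =>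
    pow_le_pow_left₀ hl0.le (lbar_monotone (Nat.zero_le k)) 2
  have main := sum_div_mul_logPlus_sq_le (a := fun k => ‖g k‖ ^ 2)
    (b := fun k => gradSqSumPred g k + 16 * lbar ℓ x k ^ 2)
    (c := fun k => 1 + (k : ℝ) * lbar ℓ x k ^ 2 / lbar ℓ x 0 ^ 2) (l := lbar ℓ x 0 ^ 2)
    (by positivity) (fun k => sq_nonneg _) t
    (fun k hk => by
      have h1 := hG' k hk
      have h2 := hlm k
      change _ + gradSqSumPred g (k + 1) ≤ _
      linarith [sq_nonneg (lbar ℓ x k)])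
    (fun k hk => by
      have h1 := hG k hk.le
      change 1 + gradSqSumPred g k / _ ≤ _
      gcongr)
    (fun k hk => by
      have h1 := hG' k hk
      have h2 := hG k hk.le
      change 1 + gradSqSumPred g (k + 1) / _ ≤ _
      have h3 : gradSqSumPred g (k + 1) ≤ (k + 1) * lbar ℓ x k ^ 2 := by linarith
      rw [← sub_nonneg]
      have e : 2 * (1 + (k : ℝ) * lbar ℓ x k ^ 2 / lbar ℓ x 0 ^ 2)
          - (1 + gradSqSumPred g (k + 1) / lbar ℓ x 0 ^ 2)
          = (lbar ℓ x 0 ^ 2 + 2 * k * lbar ℓ x k ^ 2 - gradSqSumPred g (k + 1))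
            / lbar ℓ x 0 ^ 2 := by field_simp; ring
      rw [e]
      refine div_nonneg ?_ (sq_nonneg _)
      -- For k ≥ 1 the bound uses k + 1 ≤ 2k; at k = 0 the constant term ℓ̄_0² must pay instead.
      rcases Nat.eq_zero_or_pos k with rfl | hk0
      · simp at h3 ⊢; linarith
      · have : (1 : ℝ) ≤ k := by exact_mod_cast hk0
        nlinarith [sq_nonneg (lbar ℓ x k), sq_nonneg (lbar ℓ x 0)])
  have hlog : 0 ≤ 2 / logPlus (1 + (∑ i ∈ Finset.range t, ‖g i‖ ^ 2) / lbar ℓ x 0 ^ 2) := by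
    have := one_le_logPlus (z := 1 + (∑ i ∈ Finset.range t, ‖g i‖ ^ 2) / lbar ℓ x 0 ^ 2)
      (by have : 0 ≤ (∑ i ∈ Finset.range t, ‖g i‖ ^ 2) / lbar ℓ x 0 ^ 2 := by positivity
          linarith)
    positivity
  have e : ∀ k, ‖g k‖ ^ 2 / tdogG ℓ T δ x g k = ‖g k‖ ^ 2 /
      (logPlus (1 + (k : ℝ) * lbar ℓ x k ^ 2 / lbar ℓ x 0 ^ 2) ^ 2
        * (gradSqSumPred g k + 16 * lbar ℓ x k ^ 2)) / (8 ^ 4 * theta T δ ^ 2) := by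
    intro k
    rw [div_div]; congr 1; unfold tdogG; ring
  simp only [e, ← Finset.sum_div]
  gcongr
  linarith

/-- While the iterates have not left the ball of radius `3 d`, the squared step lengths sum to a
small multiple of `d²`. -/
theorem sum_tdogStep_sq_le (hrε : 0 < rε) (hθ : 0 < theta T δ) (hl : 0 < ℓ (x 0)) {t : ℕ} {d : ℝ}
    (hg : ∀ k < t, ‖g k‖ ≤ ℓ (x k)) (hr : ∀ k < t, rbar rε x k ≤ 3 * d) :
    ∑ k ∈ Finset.range t, tdogStep ℓ rε T δ x g k ^ 2 * ‖g k‖ ^ 2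
      ≤ 18 * d ^ 2 / (8 ^ 4 * theta T δ ^ 2) := by
  have h1 := sum_norm_sq_div_tdogG_le (T := T) (δ := δ) hl hg
  calc ∑ k ∈ Finset.range t, tdogStep ℓ rε T δ x g k ^ 2 * ‖g k‖ ^ 2
      ≤ ∑ k ∈ Finset.range t, (3 * d) ^ 2 * (‖g k‖ ^ 2 / tdogG ℓ T δ x g k) := by
        refine Finset.sum_le_sum fun k hk => ?_
        have hk := Finset.mem_range.1 hk
        have hs := sqrt_tdogG_pos (g := g) hθ hl k
        have hG : 0 < tdogG ℓ T δ x g k := Real.sqrt_pos.1 hs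
        have hrk : 0 < rbar rε x k := hrε.trans_le (le_rbar rε x k)
        have := hr k hk
        unfold tdogStep
        rw [div_pow, Real.sq_sqrt hG.le, div_mul_eq_mul_div, ← mul_div_assoc]
        gcongr
    _ = (3 * d) ^ 2 * ∑ k ∈ Finset.range t, ‖g k‖ ^ 2 / tdogG ℓ T δ x g k := by
        rw [Finset.mul_sum]
    _ ≤ (3 * d) ^ 2 * (2 / (8 ^ 4 * theta T δ ^ 2)) := by gcongr
    _ = _ := by ring

/-! ### Stability of the iterates -/

/-- The predictable directions which test the stochastic gradients: differences to the minimizer,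
switched off once the iterates have left the ball of radius `3 d` around the start. -/
noncomputable def stoppedDirection (rε : ℝ) (x : ℕ → EuclideanSpace ℝ (Fin n))
    (xs : EuclideanSpace ℝ (Fin n)) (k : ℕ) : EuclideanSpace ℝ (Fin n) :=
  {r : ℝ | r ≤ 3 * ‖x 0 - xs‖}.indicator (fun _ => x k - xs) (rbar rε x k)

theorem stoppedDirection_eq {xs : EuclideanSpace ℝ (Fin n)} {k : ℕ}
    (h : rbar rε x k ≤ 3 * ‖x 0 - xs‖) : stoppedDirection rε x xs k = x k - xs :=
  Set.indicator_of_mem (show rbar rε x k ∈ {r : ℝ | r ≤ 3 * ‖x 0 - xs‖} from h) _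

theorem stoppedDirection_eq_zero {xs : EuclideanSpace ℝ (Fin n)} {k : ℕ}
    (h : ¬ rbar rε x k ≤ 3 * ‖x 0 - xs‖) : stoppedDirection rε x xs k = 0 :=
  Set.indicator_of_notMem (show rbar rε x k ∉ {r : ℝ | r ≤ 3 * ‖x 0 - xs‖} from h) _

theorem norm_sub_le_four_mul {xs : EuclideanSpace ℝ (Fin n)} {k t : ℕ} (hk : k ≤ t)
    (h : rbar rε x t ≤ 3 * ‖x 0 - xs‖) : ‖x k - xs‖ ≤ 4 * ‖x 0 - xs‖ := by
  have h1 := norm_sub_le_norm_sub_add_norm_sub (x k) (x 0) xs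
  have h2 := norm_sub_le_rbar (rε := rε) (x := x) hk
  linarith

/-- The numerical estimate closing the stability induction. -/
theorem sq_distance_budget {d θ Q I c : ℝ} (hd : 0 < d) (hθ4 : 4 ≤ θ) (hQ0 : 0 ≤ Q)
    (hQ : Q ≤ 18 * d ^ 2 / (8 ^ 4 * θ ^ 2)) (hc : c ≤ θ)
    (h : -(10 * θ / d ^ 2 * I) ≤ c + (10 * θ / d ^ 2) ^ 2 * (4 * d) ^ 2 * Q) :
    d ^ 2 + Q - 2 * I ≤ (2 * d) ^ 2 := by
  -- Division by the scale λ = 10θ/d²: c/λ ≤ d²/10 and 16 d² λ = 160 θ. Since θ ≥ 4, the term 320 θQ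
  -- is at most 320 · 18 d² / (4 · 4096), well within the budget of 4d².
  have e4 : -I ≤ d ^ 2 / 10 + 160 * (θ * Q) := by
    have h1 : 10 * θ / d ^ 2 * (d ^ 2 / 10 + 160 * (θ * Q))
        = θ + (10 * θ / d ^ 2) ^ 2 * (4 * d) ^ 2 * Q := by field_simp; ring
    have h2 : 0 < 10 * θ / d ^ 2 := by positivity
    have h3 : 10 * θ / d ^ 2 * -I ≤ 10 * θ / d ^ 2 * (d ^ 2 / 10 + 160 * (θ * Q)) := by
      rw [h1, mul_neg]; linarith
    exact le_of_mul_le_mul_left h3 h2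
  have e5 : Q * (8 ^ 4 * θ ^ 2) ≤ 18 * d ^ 2 := by
    rwa [le_div_iff₀ (by positivity)] at hQ
  have e6 : 4 * (θ * Q) ≤ θ * (θ * Q) := mul_le_mul_of_nonneg_right hθ4 (by positivity)
  have e7 : 4 * Q ≤ θ * Q := mul_le_mul_of_nonneg_right hθ4 hQ0
  have e8 : θ * (θ * Q) * 4096 ≤ 18 * d ^ 2 := by linarith
  linarith [sq_nonneg d]

/-- On the event of the concentration inequality for the normalized steps, the iterates stay in
the ball of radius `3 d₀`. -/
theorem IsTDoGRun.rbar_le_of_concentration (h : IsTDoGRun X ℓ x₀ rε T δ x g) (hX : IsClosed X)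
    (hc : Convex ℝ X) (h₀ : x₀ ∈ X) {xs : EuclideanSpace ℝ (Fin n)} (hxs : xs ∈ X)
    (hd : 0 < ‖x 0 - xs‖) (hrε : 0 < rε) (hrd : rε ≤ 3 * ‖x 0 - xs‖) (hT : 1 ≤ T) (hδ : 0 < δ)
    (hδ' : δ < 1 / 2) (hl : 0 < ℓ (x 0)) (hg : ∀ k < T, ‖g k‖ ≤ ℓ (x k))
    {m : ℕ → EuclideanSpace ℝ (Fin n)} (hm : ∀ k < T, 0 ≤ inner ℝ (m k) (x k - xs))
    (hcon : ∀ t ≤ T, ∑ k ∈ Finset.range t, inner ℝ (g k - m k)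
        ((-(10 * theta T δ / ‖x 0 - xs‖ ^ 2 * tdogStep ℓ rε T δ x g k))
          • stoppedDirection rε x xs k)
      ≤ Real.log (1 / δ) + ∑ k ∈ Finset.range t, inner ℝ (g k)
        ((-(10 * theta T δ / ‖x 0 - xs‖ ^ 2 * tdogStep ℓ rε T δ x g k))
          • stoppedDirection rε x xs k) ^ 2) :
    ∀ t ≤ T, rbar rε x t ≤ 3 * ‖x 0 - xs‖ := by
  have hθ4 := four_le_theta hT hδ hδ'
  have hθd := add_le_theta hT hδ
  have hθ : 0 < theta T δ := by linarith
  set d := ‖x 0 - xs‖ with hdd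
  set θ := theta T δ with hθθ
  set η := fun k => tdogStep ℓ rε T δ x g k with hη
  have hη0 : ∀ k, 0 ≤ η k := fun k =>
    (div_pos (hrε.trans_le (le_rbar rε x k)) (sqrt_tdogG_pos hθ hl k)).le
  intro t
  induction t with
  | zero => intro _; rw [rbar_zero hrε.le]; exact hrd
  | succ t ih =>
    intro ht
    have hrt := ih (by omega)
    have hrk : ∀ k < t + 1, rbar rε x k ≤ 3 * d := fun k hk =>
      (rbar_monotone (Nat.lt_succ_iff.1 hk)).trans hrt
    have hdir : ∀ k < t + 1, stoppedDirection rε x xs k = x k - xs := fun k hk =>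
      stoppedDirection_eq (hrk k hk)
    have hQ := sum_tdogStep_sq_le (T := T) (δ := δ) hrε hθ hl (t := t + 1)
      (fun k hk => hg k (by omega)) hrk
    set Q := ∑ k ∈ Finset.range (t + 1), tdogStep ℓ rε T δ x g k ^ 2 * ‖g k‖ ^ 2 with hQd
    have hQ0 : 0 ≤ Q := Finset.sum_nonneg fun k _ => by positivity
    set lam := 10 * θ / d ^ 2 with hlam
    have hlam0 : 0 < lam := by positivity
    set I := ∑ k ∈ Finset.range (t + 1), η k * inner ℝ (g k) (x k - xs) with hI
    have htel : ‖x (t + 1) - xs‖ ^ 2 ≤ d ^ 2 + Q - 2 * I := by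
      have := Finset.sum_le_sum fun k (hk : k ∈ Finset.range (t + 1)) =>
        h.two_mul_inner_le hX hc h₀ hxs (show k < T by have := Finset.mem_range.1 hk; omega)
      rw [Finset.sum_add_distrib, Finset.sum_range_sub' (fun k => ‖x k - xs‖ ^ 2),
        ← Finset.mul_sum] at this
      linarith
    have hc1 := hcon (t + 1) ht
    -- The drift -λ η_k ⟨m_k, x_k - xs⟩ is nonpositive and has the favourable sign, so it is
    -- dropped.
    have e1 : -(lam * I) ≤ ∑ k ∈ Finset.range (t + 1), inner ℝ (g k - m k)
        ((-(lam * tdogStep ℓ rε T δ x g k)) • stoppedDirection rε x xs k) := by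
      rw [hI, Finset.mul_sum, ← Finset.sum_neg_distrib]
      refine Finset.sum_le_sum fun k hk => ?_
      have hk := Finset.mem_range.1 hk
      have h1 := mul_nonneg (mul_nonneg hlam0.le (hη0 k)) (hm k (by omega))
      rw [hdir k hk, inner_smul_right, inner_sub_left]
      simp only [hη] at h1 ⊢
      linarith
    have e2 : ∑ k ∈ Finset.range (t + 1), inner ℝ (g k)
        ((-(lam * tdogStep ℓ rε T δ x g k)) • stoppedDirection rε x xs k) ^ 2
        ≤ lam ^ 2 * (4 * d) ^ 2 * Q := by
      rw [hQd, Finset.mul_sum]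
      refine Finset.sum_le_sum fun k hk => ?_
      have hk := Finset.mem_range.1 hk
      rw [hdir k hk, inner_smul_right, mul_pow, neg_sq, mul_pow]
      have h1 := abs_real_inner_le_norm (g k) (x k - xs)
      have h2 := norm_sub_le_four_mul (le_refl k) (hrk k hk)
      have h3 : inner ℝ (g k) (x k - xs) ^ 2 ≤ (‖g k‖ * (4 * d)) ^ 2 := by
        rw [← sq_abs]
        have := h1.trans (mul_le_mul_of_nonneg_left h2 (norm_nonneg _))
        gcongr
      calc _ ≤ lam ^ 2 * tdogStep ℓ rε T δ x g k ^ 2 * (‖g k‖ * (4 * d)) ^ 2 := by gcongr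
        _ = _ := by ring
    have e3 : -(lam * I) ≤ Real.log (1 / δ) + lam ^ 2 * (4 * d) ^ 2 * Q := by linarith
    have e8 : ‖x (t + 1) - xs‖ ^ 2 ≤ (2 * d) ^ 2 :=
      htel.trans (sq_distance_budget hd hθ4 hQ0 hQ (by linarith) e3)
    -- Distance 2d from the minimizer is distance at most 3d from the start, which closes the
    -- induction and keeps the stopping inactive.
    have e9 : ‖x (t + 1) - xs‖ ≤ 2 * d :=
      (sq_le_sq₀ (norm_nonneg _) (by positivity)).1 e8
    refine rbar_le_iff.2 ⟨fun k hk => ?_, hrd⟩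
    rcases Nat.lt_or_ge k (t + 1) with hk' | hk'
    · exact (norm_sub_le_rbar (Nat.lt_succ_iff.1 hk')).trans hrt
    · rw [show k = t + 1 by omega]
      have := norm_sub_le_norm_sub_add_norm_sub (x (t + 1)) xs (x 0)
      rw [norm_sub_rev xs] at this
      linarith

end Run

/-! ### Selecting a dyadic scale -/

/-- Choosing the best scale `2 ^ j` in a family of linear-quadratic bounds. -/
theorem le_sqrt_mul_of_scales {b U V A S : ℝ} {T : ℕ} (hb : 0 < b) (hVU : V ≤ U)
    (hbU : b ^ 2 ≤ U) (hU : U ≤ (T + 1) * b ^ 2) (hA : 0 ≤ A)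
    (h : ∀ j ≤ Nat.log 2 (T + 1),
      (2 * b * 2 ^ j)⁻¹ * S ≤ A + ((2 * b * 2 ^ j)⁻¹) ^ 2 * V) :
    S ≤ √U * (1 + 2 * A) := by
  have hsU : √U ^ 2 = U := Real.sq_sqrt ((sq_nonneg b).trans hbU)
  have hbs : b ≤ √U := Real.le_sqrt_of_sq_le hbU
  set q := √U / b with hq
  have hq1 : 1 ≤ q := by rw [hq, le_div_iff₀ hb]; linarith
  have hqT : q ≤ T + 1 := by
    have h1 : q ^ 2 ≤ T + 1 := by
      rw [hq, div_pow, hsU, div_le_iff₀ (by positivity)]; exact hU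
    nlinarith
  -- With j = ⌊log₂ N⌋ the scale B = b 2^j satisfies B ≤ √U ≤ 2B, so both 2BA and V/(2B) are of
  -- order √U.
  set N := ⌊q⌋₊ with hN
  have hN1 : 1 ≤ N := Nat.le_floor (by simpa using hq1)
  have hNq : (N : ℝ) ≤ q := Nat.floor_le (by linarith)
  have hqN : q < N + 1 := Nat.lt_floor_add_one q
  set j := Nat.log 2 N with hj
  have hjT : j ≤ Nat.log 2 (T + 1) :=
    Nat.log_mono_right (by exact_mod_cast hNq.trans hqT)
  have h1 : (2 : ℝ) ^ j ≤ N := by exact_mod_cast Nat.pow_log_le_self 2 (by omega)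
  have h2 : (N : ℝ) + 1 ≤ 2 ^ (j + 1) := by
    exact_mod_cast Nat.lt_pow_succ_log_self (by norm_num) N
  set B := b * 2 ^ j with hB
  have hB0 : 0 < B := by positivity
  have hBU : B ≤ √U := by
    have := h1.trans hNq
    rw [hq, le_div_iff₀ hb] at this
    rw [hB]; linarith
  have hUB : √U ≤ 2 * B := by
    have := hqN.le.trans h2
    rw [hq, div_le_iff₀ hb, pow_succ] at this
    rw [hB]; linarith
  have hj' := h j hjT
  rw [mul_assoc 2 b, ← hB] at hj'
  have h3 : S ≤ 2 * B * A + V / (2 * B) := by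
    have := mul_le_mul_of_nonneg_left hj' (show 0 ≤ 2 * B by positivity)
    have e1 : 2 * B * ((2 * B)⁻¹ * S) = S := by field_simp
    have e2 : 2 * B * (A + ((2 * B)⁻¹) ^ 2 * V) = 2 * B * A + V / (2 * B) := by field_simp
    rwa [e1, e2] at this
  have h4 : V / (2 * B) ≤ √U := by
    rw [div_le_iff₀ (by positivity)]
    nlinarith [Real.sqrt_nonneg U]
  nlinarith

/-! ### Regret and suboptimality on the good events -/

section Run

variable {n : ℕ} {X : Set (EuclideanSpace ℝ (Fin n))} {f ℓ : EuclideanSpace ℝ (Fin n) → ℝ}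
  {x₀ xs : EuclideanSpace ℝ (Fin n)} {rε δ : ℝ} {T : ℕ} {x g : ℕ → EuclideanSpace ℝ (Fin n)}

/-- The weighted regret bound on the event where the iterates stay in the ball of radius
`3 d₀`. -/
theorem IsTDoGRun.weighted_regret_le (h : IsTDoGRun X ℓ x₀ rε T δ x g) (hX : IsClosed X)
    (hc : Convex ℝ X) (h₀ : x₀ ∈ X) (hxs : xs ∈ X) (hrε : 0 < rε)
    (hθ : 1 ≤ theta T δ) (hl : 0 < ℓ (x 0)) (hg : ∀ k < T, ‖g k‖ ≤ ℓ (x k)) {t : ℕ} (ht : t < T)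
    (hr : rbar rε x (t + 1) ≤ 3 * ‖x 0 - xs‖) :
    ∑ k ∈ Finset.range (t + 1), rbar rε x k * inner ℝ (g k) (x k - xs)
      ≤ rbar rε x (t + 1) * ‖x 0 - xs‖
        * (8 * √(tdogG ℓ T δ x g t) + 3 * √(gradSqSumPred g (t + 1))) := by
  set d := ‖x 0 - xs‖ with hd
  set s := fun k => √(tdogG ℓ T δ x g k) with hs
  set r := rbar rε x (t + 1) with hrd
  have hr0 : 0 < r := hrε.trans_le (le_rbar rε x _)
  have hs0 : ∀ k, 0 < s k := fun k => sqrt_tdogG_pos (by linarith) hl k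
  -- M majorizes every earlier squared distance: two distances differ by at most 2r and sum to at
  -- most 8d. Only the excess 16 r d survives the summation by parts, which gives a bound linear in
  -- r.
  set M := ‖x (t + 1) - xs‖ ^ 2 + 16 * r * d with hM
  have hu : ∀ k ≤ t, ‖x k - xs‖ ^ 2 ≤ M := by
    intro k hk
    have h1 := norm_sub_le_four_mul (show k ≤ t + 1 by omega) hr
    have h2 := norm_sub_le_four_mul (le_refl (t + 1)) hr
    have h3 : ‖x k - xs‖ ≤ ‖x (t + 1) - xs‖ + 2 * r := by
      have h4 := norm_sub_le_norm_sub_add_norm_sub (x k) (x (t + 1)) xs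
      have h5 := norm_sub_le_norm_sub_add_norm_sub (x k) (x 0) (x (t + 1))
      have h6 := norm_sub_le_rbar (rε := rε) (x := x) (show k ≤ t + 1 by omega)
      have h7 := norm_sub_le_rbar (rε := rε) (x := x) (le_refl (t + 1))
      rw [norm_sub_rev (x 0)] at h5
      linarith
    have h8 := norm_nonneg (x k - xs)
    have h9 := norm_nonneg (x (t + 1) - xs)
    rw [hM]
    rw [← hd] at h1 h2
    rcases le_total ‖x k - xs‖ ‖x (t + 1) - xs‖ with h10 | h10
    · have := pow_le_pow_left₀ h8 h10 2
      have : 0 ≤ 16 * r * d := by positivity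
      linarith
    · have : (‖x k - xs‖ - ‖x (t + 1) - xs‖) * (‖x k - xs‖ + ‖x (t + 1) - xs‖)
          ≤ (2 * r) * (8 * d) :=
        mul_le_mul (by linarith) (by linarith) (by linarith) (by linarith)
      linarith
  have hAbel := sum_mul_sub_succ_le (s := s) (u := fun k => ‖x k - xs‖ ^ 2) (M := M)
    (fun k => sqrt_tdogG_mono (by linarith) hl (Nat.le_succ k)) (hs0 0).le t hu
  have hgs := sum_div_le_two_mul_sqrt (a := fun k => ‖g k‖ ^ 2) (s := s) (fun k => sq_nonneg _)
    (t + 1) (fun k hk => by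
      have h1 := mul_sqrt_le_sqrt_tdogG (ℓ := ℓ) (x := x) (g := g) (by linarith : 0 ≤ theta T δ) k
      have h2 : ‖g k‖ ^ 2 ≤ lbar ℓ x k ^ 2 :=
        pow_le_pow_left₀ (norm_nonneg _) ((hg k (by omega)).trans (le_lbar le_rfl)) 2
      have h3 : √(∑ i ∈ Finset.range (k + 1), ‖g i‖ ^ 2)
          ≤ √(gradSqSumPred g k + 16 * lbar ℓ x k ^ 2) := by
        refine Real.sqrt_le_sqrt ?_
        rw [Finset.sum_range_succ]
        unfold gradSqSumPred
        linarith [sq_nonneg (lbar ℓ x k)]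
      have h4 := Real.sqrt_nonneg (gradSqSumPred g k + 16 * lbar ℓ x k ^ 2)
      simp only [hs]
      nlinarith)
  -- Multiplying the step inequality by s_k turns the step size r̄_k / s_k into the weight r̄_k of
  -- the average.
  have hterm : ∀ k ∈ Finset.range (t + 1), rbar rε x k * inner ℝ (g k) (x k - xs)
      ≤ 1 / 2 * (s k * (‖x k - xs‖ ^ 2 - ‖x (k + 1) - xs‖ ^ 2)) + r ^ 2 / 2 * (‖g k‖ ^ 2 / s k) := by
    intro k hk
    have hk := Finset.mem_range.1 hk
    have h1 := h.two_mul_inner_le hX hc h₀ hxs (show k < T by omega)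
    have hsk := hs0 k
    have hη : tdogStep ℓ rε T δ x g k = rbar rε x k / s k := rfl
    rw [hη] at h1
    have h2 := mul_le_mul_of_nonneg_left h1 hsk.le
    have h3 : rbar rε x k ^ 2 ≤ r ^ 2 :=
      pow_le_pow_left₀ (hrε.trans_le (le_rbar rε x _)).le (rbar_monotone (by omega)) 2
    have h4 : rbar rε x k ^ 2 * (‖g k‖ ^ 2 / s k) ≤ r ^ 2 * (‖g k‖ ^ 2 / s k) := by gcongr
    have e1 : s k * (2 * (rbar rε x k / s k * inner ℝ (g k) (x k - xs)))
        = 2 * (rbar rε x k * inner ℝ (g k) (x k - xs)) := by field_simp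
    have e2 : s k * (‖x k - xs‖ ^ 2 - ‖x (k + 1) - xs‖ ^ 2 + (rbar rε x k / s k) ^ 2 * ‖g k‖ ^ 2)
        = s k * (‖x k - xs‖ ^ 2 - ‖x (k + 1) - xs‖ ^ 2)
          + rbar rε x k ^ 2 * (‖g k‖ ^ 2 / s k) := by field_simp
    rw [e1, e2] at h2
    linarith
  have hsum := Finset.sum_le_sum hterm
  rw [Finset.sum_add_distrib, ← Finset.mul_sum, ← Finset.mul_sum] at hsum
  have hG : √(∑ i ∈ Finset.range (t + 1), ‖g i‖ ^ 2) = √(gradSqSumPred g (t + 1)) := rfl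
  rw [hG] at hgs
  have hr2 : r ^ 2 ≤ r * (3 * d) := by nlinarith
  have h5 : r ^ 2 / 2 * ∑ k ∈ Finset.range (t + 1), ‖g k‖ ^ 2 / s k
      ≤ r * (3 * d) * √(gradSqSumPred g (t + 1)) := by
    calc _ ≤ r ^ 2 / 2 * (2 * √(gradSqSumPred g (t + 1))) := by gcongr
      _ = r ^ 2 * √(gradSqSumPred g (t + 1)) := by ring
      _ ≤ _ := by gcongr
  have h6 : s t * (M - ‖x (t + 1) - xs‖ ^ 2) = 16 * r * d * s t := by rw [hM]; ring
  rw [h6] at hAbel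
  linarith

/-- The T-DoG denominators in terms of the factors of the final bound. -/
theorem sqrt_tdogG_le (hT : 1 ≤ T) (hδ : 0 < δ) (hδ' : δ < 1 / 2) (hl : 0 < ℓ (x 0)) {t : ℕ}
    (ht : t < T) {L z : ℝ} (hL : ∀ k ≤ t, ℓ (x k) ≤ L) (hz : L / ℓ (x 0) ≤ z) :
    √(tdogG ℓ T δ x g t) ≤ 4096 * logPlus (T * z) * Real.log (logPlus T / δ)
      * √(gradSqSumPred g (t + 1) + L ^ 2) := by
  have hθ4 := four_le_theta hT hδ hδ'
  have hθ := theta_le hT hδ hδ'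
  have hlt := lbar_pos hl t
  have hlL : lbar ℓ x t ≤ L := lbar_le_iff.2 hL
  have h0L : ℓ (x 0) ≤ L := hL 0 (Nat.zero_le t)
  have hz1 : 1 ≤ z := by
    refine le_trans ?_ hz
    rw [le_div_iff₀ hl]; linarith
  have hT1 : (1 : ℝ) ≤ T := by exact_mod_cast hT
  have htT : (t : ℝ) ≤ T := by exact_mod_cast ht.le
  have hlz : lbar ℓ x t ^ 2 / ℓ (x 0) ^ 2 ≤ z ^ 2 := by
    rw [← div_pow]
    refine pow_le_pow_left₀ (by positivity) (le_trans ?_ hz) 2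
    gcongr
  -- The unknown ratio ℓ̄_t / ℓ(x₀) is at most z, so the argument is at most 2 (T z)²; the square
  -- costs only a factor 2 outside the logarithm.
  have hlog : logPlus (1 + (t : ℝ) * lbar ℓ x t ^ 2 / lbar ℓ x 0 ^ 2) ≤ 2 * logPlus (T * z) := by
    have h1 : 1 + (t : ℝ) * lbar ℓ x t ^ 2 / lbar ℓ x 0 ^ 2 ≤ 2 * (T * z) ^ 2 := by
      rw [lbar_zero, mul_div_assoc]
      have h2 : (t : ℝ) * (lbar ℓ x t ^ 2 / ℓ (x 0) ^ 2) ≤ T * z ^ 2 := by gcongr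
      have h3 : (T : ℝ) * z ^ 2 ≤ (T * z) ^ 2 := by
        rw [mul_pow]; gcongr; nlinarith
      have h4 : 1 ≤ (T * z) ^ 2 := one_le_pow₀ (by nlinarith)
      linarith
    have h5 := logPlus_le_logPlus (by rw [lbar_zero]; positivity) h1
    have h6 : logPlus (2 * (T * z) ^ 2) = 1 + Real.log 2 + 2 * Real.log (T * z) := by
      unfold logPlus
      rw [Real.log_mul (by norm_num) (by positivity), Real.log_pow]
      push_cast; ring
    have h7 := Real.log_two_lt_d9
    rw [h6] at h5
    refine h5.trans ?_
    unfold logPlus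
    linarith
  have hlog0 := one_le_log_term (ℓ := ℓ) (x := x) t
  have hsq : √(gradSqSumPred g t + 16 * lbar ℓ x t ^ 2)
      ≤ 4 * √(gradSqSumPred g (t + 1) + L ^ 2) := by
    have e : 4 * √(gradSqSumPred g (t + 1) + L ^ 2)
        = √(4 ^ 2 * (gradSqSumPred g (t + 1) + L ^ 2)) := by
      rw [Real.sqrt_mul (by norm_num), Real.sqrt_sq (by norm_num)]
    rw [e]
    refine Real.sqrt_le_sqrt ?_
    have h1 := gradSqSumPred_monotone (g := g) (Nat.le_succ t)
    have h2 := gradSqSumPred_nonneg (g := g) t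
    have h3 := pow_le_pow_left₀ hlt.le hlL 2
    simp only [Nat.succ_eq_add_one] at h1
    linarith
  rw [sqrt_tdogG (by linarith)]
  have hc := half_le_log_logPlus_div hT hδ hδ'
  have hzT : 1 ≤ logPlus (T * z) := one_le_logPlus (by nlinarith)
  calc _ ≤ 64 * (8 * Real.log (logPlus T / δ)) * (2 * logPlus (T * z))
        * (4 * √(gradSqSumPred g (t + 1) + L ^ 2)) := by gcongr
    _ = _ := by ring

/-- Jensen's inequality and the subgradient inequality for the weighted average. -/
theorem sum_mul_sub_le_sum_inner (hf : ConvexOn ℝ X f) (hxs : xs ∈ X) (hrε : 0 < rε) {t : ℕ}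
    (ht : 0 < t) (hx : ∀ k < t, x k ∈ X) {m : ℕ → EuclideanSpace ℝ (Fin n)}
    (hm : ∀ k < t, m k ∈ subdifferentialOn X f (x k)) :
    (∑ k ∈ Finset.range t, rbar rε x k) * (f (weightedAvg rε x t) - f xs)
      ≤ ∑ k ∈ Finset.range t, rbar rε x k * inner ℝ (m k) (x k - xs) := by
  have hr : ∀ k, 0 < rbar rε x k := fun k => hrε.trans_le (le_rbar rε x k)
  set W := ∑ k ∈ Finset.range t, rbar rε x k with hW
  have hW0 : 0 < W := Finset.sum_pos (fun k _ => hr k) ⟨0, Finset.mem_range.2 ht⟩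
  have hJ := hf.map_centerMass_le (t := Finset.range t) (w := rbar rε x) (p := x)
    (fun k _ => (hr k).le) hW0 (fun k hk => hx k (Finset.mem_range.1 hk))
  have hJ' : f (weightedAvg rε x t) ≤ W⁻¹ * ∑ k ∈ Finset.range t, rbar rε x k * f (x k) := by
    simpa [Finset.centerMass, weightedAvg] using hJ
  have h1 : W * f (weightedAvg rε x t) ≤ ∑ k ∈ Finset.range t, rbar rε x k * f (x k) := by
    have := mul_le_mul_of_nonneg_left hJ' hW0.le
    rwa [mul_inv_cancel_left₀ hW0.ne'] at this
  have h2 : ∑ k ∈ Finset.range t, rbar rε x k * (f (x k) - f xs)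
      ≤ ∑ k ∈ Finset.range t, rbar rε x k * inner ℝ (m k) (x k - xs) := by
    refine Finset.sum_le_sum fun k hk => mul_le_mul_of_nonneg_left ?_ (hr k).le
    have := hm k (Finset.mem_range.1 hk) xs hxs
    rw [← neg_sub, inner_neg_right] at this
    linarith
  simp only [mul_sub, Finset.sum_sub_distrib, ← Finset.sum_mul] at h2 ⊢
  linarith

/-- The ratio sum vanishes at time 0 and is positive at time 1, so the average is never over an
empty set. -/
theorem IsBestIndex.pos {τ : ℕ} (h : IsBestIndex rε x T τ) (hrε : 0 < rε) (hT : 1 ≤ T) :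
    0 < τ := by
  rcases Nat.eq_zero_or_pos τ with rfl | h0
  · have h1 := h.2 1 hT
    have h2 : 0 < rbar rε x 0 / rbar rε x 1 :=
      div_pos (hrε.trans_le (le_rbar rε x 0)) (hrε.trans_le (le_rbar rε x 1))
    simp [ratioSum] at h1
    linarith
  · exact h0

/-- The suboptimality bound on the intersection of the stability event and the event where the
noise is controlled. -/
theorem IsTDoGRun.weightedAvg_sub_le (h : IsTDoGRun X ℓ x₀ rε T δ x g) (hX : IsClosed X)
    (hf : ConvexOn ℝ X f) (h₀ : x₀ ∈ X) (hxs : xs ∈ X) (hrε : 0 < rε)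
    (hT : 1 ≤ T) (hδ : 0 < δ) (hδ' : δ < 1 / 2) (hl : 0 < ℓ (x 0))
    (hg : ∀ k < T, ‖g k‖ ≤ ℓ (x k)) {m : ℕ → EuclideanSpace ℝ (Fin n)}
    (hm : ∀ k < T, m k ∈ subdifferentialOn X f (x k))
    (hr : rbar rε x T ≤ 3 * ‖x 0 - xs‖) {L z : ℝ} (hL : ∀ k ≤ T, ℓ (x k) ≤ L)
    (hz : L / ℓ (x 0) ≤ z)
    (hnoise : ∀ t ≤ T, |∑ k ∈ Finset.range t, inner ℝ (g k - m k) (x k - xs)|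
      ≤ 40 * ‖x 0 - xs‖ * Real.log (logPlus T / δ) * √(gradSqSumPred g t + L ^ 2))
    {τ : ℕ} (hτ : IsBestIndex rε x T τ) :
    f (weightedAvg rε x τ) - f xs ≤ 100000 * (logPlus (T * z) * logPlus (3 * ‖x 0 - xs‖ / rε)
      * Real.log (logPlus T / δ) * (‖x 0 - xs‖ * √(gradSqSumPred g τ + L ^ 2) / T)) := by
  obtain ⟨t, rfl⟩ : ∃ t, τ = t + 1 := ⟨τ - 1, by have := hτ.pos hrε hT; omega⟩
  have htT : t + 1 ≤ T := hτ.1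
  have hrpos : ∀ k, 0 < rbar rε x k := fun k => hrε.trans_le (le_rbar rε x k)
  have hrt : rbar rε x (t + 1) ≤ 3 * ‖x 0 - xs‖ := (rbar_monotone htT).trans hr
  have hθ4 := four_le_theta hT hδ hδ'
  have hreg := h.weighted_regret_le hX hf.1 h₀ hxs hrε (by linarith) hl hg htT hrt
  have hs := sqrt_tdogG_le (g := g) hT hδ hδ' hl htT (fun k hk => hL k (by omega)) hz
  have hjen := sum_mul_sub_le_sum_inner (t := t + 1) hf hxs hrε (Nat.succ_pos t)
    (fun k hk => h.mem hX h₀ (by omega)) (fun k hk => hm k (by omega))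
  have hc3 := half_le_log_logPlus_div hT hδ hδ'
  have hT1 : (1 : ℝ) ≤ T := by exact_mod_cast hT
  have hz1 : 1 ≤ z := by
    refine le_trans ?_ hz
    rw [le_div_iff₀ hl]; linarith [hL 0 (Nat.zero_le T)]
  have hc1 : 1 ≤ logPlus (T * z) := one_le_logPlus (by nlinarith)
  have hnse := abs_sum_mul_le (r := rbar rε x) (a := fun k => inner ℝ (g k - m k) (x k - xs))
    (B := 40 * ‖x 0 - xs‖ * Real.log (logPlus T / δ) * √(gradSqSumPred g (t + 1) + L ^ 2))
    rbar_monotone (hrpos 0).le (t + 1) (fun i hi => by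
      refine (hnoise i (hi.trans htT)).trans ?_
      have := gradSqSumPred_monotone (g := g) hi
      gcongr)
  have hratio := le_mul_logPlus_of_ratio_le (s := rbar rε x) (R := ratioSum rε x (t + 1)) hrpos
    (fun k => rbar_monotone (Nat.le_succ k))
    (fun k hk => h.rbar_succ_le hX hf.1 h₀ hrε (by linarith) hl hk (hg k hk)) hτ.2
  rw [rbar_zero hrε.le] at hratio
  have hc2 : logPlus (rbar rε x T / rε) ≤ logPlus (3 * ‖x 0 - xs‖ / rε) :=
    logPlus_le_logPlus (div_pos (hrpos T) hrε) (by gcongr)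
  have hsG : √(gradSqSumPred g (t + 1)) ≤ √(gradSqSumPred g (t + 1) + L ^ 2) :=
    Real.sqrt_le_sqrt (by linarith [sq_nonneg L])
  set d := ‖x 0 - xs‖ with hd
  set c1 := logPlus (T * z)
  set c2 := logPlus (3 * d / rε)
  set c3 := Real.log (logPlus T / δ)
  set q := √(gradSqSumPred g (t + 1) + L ^ 2)
  set W := ∑ k ∈ Finset.range (t + 1), rbar rε x k with hW
  set r := rbar rε x (t + 1) with hrd
  have hr0 : 0 < r := hrpos _
  have hq0 : 0 ≤ q := Real.sqrt_nonneg _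
  have hd0 : 0 ≤ d := norm_nonneg _
  have hsplit : ∑ k ∈ Finset.range (t + 1), rbar rε x k * inner ℝ (m k) (x k - xs)
      = ∑ k ∈ Finset.range (t + 1), rbar rε x k * inner ℝ (g k) (x k - xs)
        - ∑ k ∈ Finset.range (t + 1), rbar rε x k * inner ℝ (g k - m k) (x k - xs) := by
    rw [← Finset.sum_sub_distrib]
    refine Finset.sum_congr rfl fun k _ => ?_
    rw [inner_sub_left]; ring
  have hqc : q ≤ 2 * (c1 * c3 * q) := by
    have : 1 ≤ 2 * (c1 * c3) := by nlinarith
    nlinarith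
  have hcq : c3 * q ≤ c1 * c3 * q := by
    have : 0 ≤ c3 * q := by positivity
    nlinarith
  -- The count is 8 · 4096 + 6 + 80 < 50000; the factor 2 of the best-index bound makes it 100000.
  have hbr : 8 * √(tdogG ℓ T δ x g t) + 3 * √(gradSqSumPred g (t + 1)) + 80 * (c3 * q)
      ≤ 50000 * (c1 * c3 * q) := by
    have : 0 ≤ c1 * c3 * q := by positivity
    linarith
  have hmain : W * (f (weightedAvg rε x (t + 1)) - f xs) ≤ r * d * (50000 * (c1 * c3 * q)) := by
    have h1 := (abs_le.1 hnse).1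
    have h2 := mul_le_mul_of_nonneg_left hbr (mul_nonneg hr0.le hd0)
    rw [hsplit] at hjen
    linarith
  have hRW : ratioSum rε x (t + 1) = W / r := by
    unfold ratioSum; rw [← Finset.sum_div]
  have hW0 : 0 < W := Finset.sum_pos (fun k _ => hrpos k) ⟨0, Finset.mem_range.2 (Nat.succ_pos t)⟩
  have hTW : T * r ≤ 2 * W * c2 := by
    have h1 : (T : ℝ) ≤ 2 * (W / r) * c2 := by
      refine hratio.trans ?_
      rw [hRW]; gcongr
    have h2 := mul_le_mul_of_nonneg_right h1 hr0.le
    have e : 2 * (W / r) * c2 * r = 2 * W * c2 := by field_simp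
    rwa [e] at h2
  have hT0 : (0 : ℝ) < T := by linarith
  have e : 100000 * (c1 * c2 * c3 * (d * q / T)) = (2 * c2) * (d * (50000 * (c1 * c3 * q))) / T := by
    ring
  rw [e, le_div_iff₀ hT0]
  refine le_of_mul_le_mul_left ?_ hW0
  calc W * ((f (weightedAvg rε x (t + 1)) - f xs) * T)
      = W * (f (weightedAvg rε x (t + 1)) - f xs) * T := by ring
    _ ≤ r * d * (50000 * (c1 * c3 * q)) * T := by gcongr
    _ = (T * r) * (d * (50000 * (c1 * c3 * q))) := by ring
    _ ≤ (2 * W * c2) * (d * (50000 * (c1 * c3 * q))) := by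
        refine mul_le_mul_of_nonneg_right hTW ?_
        have : 0 ≤ c1 * c3 * q := by positivity
        positivity
    _ = _ := by ring

end Run

/-! ### Measurability of the algorithm's quantities -/

section Measurability

variable {Ω : Type*} {mΩ : MeasurableSpace Ω} {n : ℕ} {ℓ : EuclideanSpace ℝ (Fin n) → ℝ}
  {x g : ℕ → Ω → EuclideanSpace ℝ (Fin n)} {t : ℕ}

theorem measurable_rbar (rε : ℝ) (hx : ∀ k ≤ t, Measurable (x k)) :
    Measurable fun ω => rbar rε (fun k => x k ω) t := by
  refine Measurable.max (Finset.measurable_range_sup'' fun k hk => ?_) measurable_const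
  exact ((hx k hk).sub (hx 0 (Nat.zero_le t))).norm

theorem measurable_lbar (hℓ : ∀ k ≤ t, Measurable fun ω => ℓ (x k ω)) :
    Measurable fun ω => lbar ℓ (fun k => x k ω) t :=
  Finset.measurable_range_sup'' hℓ

theorem measurable_tdogStep (rε : ℝ) (T : ℕ) (δ : ℝ) (hx : ∀ k ≤ t, Measurable (x k))
    (hg : ∀ k < t, Measurable (g k)) (hℓ : ∀ k ≤ t, Measurable fun ω => ℓ (x k ω)) :
    Measurable fun ω => tdogStep ℓ rε T δ (fun k => x k ω) (fun k => g k ω) t := by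
  have h1 := measurable_rbar rε hx
  have h2 := measurable_lbar hℓ
  have h3 := measurable_lbar (t := 0) (x := x) (ℓ := ℓ)
    fun k hk => hℓ k (hk.trans (Nat.zero_le t))
  have h4 : Measurable fun ω => gradSqSumPred (fun k => g k ω) t :=
    Finset.measurable_fun_sum _ fun k hk => (hg k (Finset.mem_range.1 hk)).norm.pow_const 2
  unfold tdogStep tdogG logPlus
  fun_prop

theorem measurable_stoppedDirection {rε : ℝ} {x₀ xs : EuclideanSpace ℝ (Fin n)}
    (h0 : ∀ ω, x 0 ω = x₀) (hx : ∀ k ≤ t, Measurable (x k)) :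
    Measurable fun ω => stoppedDirection rε (fun k => x k ω) xs t := by
  have hs : MeasurableSet {ω | rbar rε (fun k => x k ω) t ≤ 3 * ‖x₀ - xs‖} :=
    measurableSet_le (measurable_rbar rε hx) measurable_const
  convert ((hx t le_rfl).sub_const xs).indicator hs using 1
  ext1 ω
  simp only [stoppedDirection, h0]
  rfl

end Measurability

/-! ### Adaptedness and the two high-probability events -/

section Probability

variable {n : ℕ} {X : Set (EuclideanSpace ℝ (Fin n))} {f ℓ : EuclideanSpace ℝ (Fin n) → ℝ}
  {x₀ xs : EuclideanSpace ℝ (Fin n)} {rε δ : ℝ} {T : ℕ}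
  {Ω : Type*} {m : MeasurableSpace Ω} {μ : Measure Ω} {ℱ : Filtration ℕ m}
  {x g : ℕ → Ω → EuclideanSpace ℝ (Fin n)}

/-- Continuity holds only on X, so ℓ is extended by zero outside; the composition does not see the
extension. -/
theorem measurable_comp_of_continuousOn {mΩ : MeasurableSpace Ω} (hX : IsClosed X)
    (hℓ : ContinuousOn ℓ X) {y : Ω → EuclideanSpace ℝ (Fin n)} (hy : Measurable y)
    (hyX : ∀ ω, y ω ∈ X) : Measurable fun ω => ℓ (y ω) := by
  classical
  have h1 : Measurable (X.piecewise ℓ 0) :=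
    ContinuousOn.measurable_piecewise hℓ continuousOn_const hX.measurableSet
  convert h1.comp hy using 1
  ext1 ω
  simp [hyX ω]

/-- The iterates of a T-DoG run are adapted. -/
theorem measurable_iterate (hX : IsClosed X) (hc : Convex ℝ X) (h₀ : x₀ ∈ X)
    (hℓ : ContinuousOn ℓ X)
    (hrun : ∀ ω, IsTDoGRun X ℓ x₀ rε T δ (fun k => x k ω) (fun k => g k ω))
    (hg : ∀ k < T, StronglyMeasurable[ℱ (k + 1)] (g k)) {k : ℕ} (hk : k ≤ T) :
    Measurable[ℱ k] (x k) := by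
  induction k using Nat.strong_induction_on with
  | _ k ih =>
    rcases k with _ | k
    · have : x 0 = fun _ => x₀ := funext fun ω => (hrun ω).init
      rw [this]
      exact measurable_const
    · have hx : ∀ i ≤ k, Measurable[ℱ (k + 1)] (x i) := fun i hi =>
        (ih i (by omega) (by omega)).mono (ℱ.mono (by omega)) le_rfl
      have hg' : ∀ i ≤ k, Measurable[ℱ (k + 1)] (g i) := fun i hi =>
        (hg i (by omega)).measurable.mono (ℱ.mono (by omega)) le_rfl
      have hη := measurable_tdogStep (mΩ := ℱ (k + 1)) rε T δ hx (fun i hi => hg' i hi.le)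
        fun i hi => measurable_comp_of_continuousOn hX hℓ (hx i hi)
          fun ω => (hrun ω).mem hX h₀ (show i ≤ T by omega)
      have : x (k + 1) = fun ω => euclideanProj X
          (x k ω - tdogStep ℓ rε T δ (fun k => x k ω) (fun k => g k ω) k • g k ω) :=
        funext fun ω => (hrun ω).step k hk
      rw [this]
      exact (lipschitzWith_euclideanProj hX hc ⟨x₀, h₀⟩).continuous.measurable.comp
        ((hx k le_rfl).sub (hη.smul (hg' k le_rfl)))

/-- The initial suboptimality is at most the oracle bound at the start times the distance to the
minimizer. -/
theorem IsOracleResponse.sub_le_mul_norm [IsProbabilityMeasure μ]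
    (h : IsOracleResponse μ ℱ X f ℓ T x g) (hxs : xs ∈ X) (h0 : ∀ ω, x 0 ω = x₀) (hT : 1 ≤ T) :
    f x₀ - f xs ≤ ℓ x₀ * ‖x₀ - xs‖ := by
  have hi := h.integrable 0 hT
  have h1 : f x₀ - f xs ≤ ∫ ω, inner ℝ (x₀ - xs) ((μ[g 0 | ℱ 0]) ω) ∂μ := by
    have := integral_mono_ae (μ := μ) (integrable_const (f x₀ - f xs))
      ((integrable_condExp (μ := μ) (m := ℱ 0) (f := g 0)).const_inner (𝕜 := ℝ) (x₀ - xs)) (by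
        filter_upwards [h.unbiased 0 hT] with ω hω
        have := hω xs hxs
        rw [h0, ← neg_sub, inner_neg_right, real_inner_comm] at this
        linarith)
    simpa using this
  have h2 : ∫ ω, inner ℝ (x₀ - xs) (g 0 ω) ∂μ ≤ ℓ x₀ * ‖x₀ - xs‖ := by
    have := integral_mono_ae (μ := μ) (hi.const_inner (𝕜 := ℝ) (x₀ - xs))
      (integrable_const (ℓ x₀ * ‖x₀ - xs‖)) (by
        filter_upwards [h.bounded 0 hT] with ω hω
        rw [h0] at hω
        refine (real_inner_le_norm _ _).trans ?_
        rw [mul_comm]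
        gcongr)
    simpa using this
  -- Since x₀ is deterministic, taking expectations replaces the conditional mean by the gradient
  -- itself, to which the norm bound applies.
  rw [integral_inner (integrable_condExp), integral_condExp, ← integral_inner hi] at h1
  exact h1.trans h2

theorem le_localBound (hX : IsClosed X) (hℓ : ContinuousOn ℓ X) {y : EuclideanSpace ℝ (Fin n)}
    (hy : y ∈ X) (hy' : ‖y - x₀‖ ≤ 3 * ‖x₀ - xs‖) : ℓ y ≤ localBound X ℓ x₀ xs := by
  have hK : IsCompact {x | x ∈ X ∧ ‖x - x₀‖ ≤ 3 * ‖x₀ - xs‖} := by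
    have : {x | x ∈ X ∧ ‖x - x₀‖ ≤ 3 * ‖x₀ - xs‖}
        = X ∩ Metric.closedBall x₀ (3 * ‖x₀ - xs‖) := by
      ext z; simp [dist_eq_norm]
    rw [this]
    exact (isCompact_closedBall _ _).inter_left hX
  exact le_csSup (hK.image_of_continuousOn (hℓ.mono fun z hz => hz.1)).bddAbove
    ⟨y, ⟨hy, hy'⟩, rfl⟩

theorem norm_stoppedDirection_le {y : ℕ → EuclideanSpace ℝ (Fin n)} {k : ℕ} :
    ‖stoppedDirection rε y xs k‖ ≤ 4 * ‖y 0 - xs‖ := by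
  by_cases h : rbar rε y k ≤ 3 * ‖y 0 - xs‖
  · rw [stoppedDirection_eq h]
    exact norm_sub_le_four_mul le_rfl h
  · rw [stoppedDirection_eq_zero h, norm_zero]
    positivity

/-- With probability at least `1 - δ`, the iterates of T-DoG stay in the ball of radius `3 d₀`. -/
theorem exists_stability_event [IsProbabilityMeasure μ] (hX : IsClosed X) (hc : Convex ℝ X)
    (h₀ : x₀ ∈ X) (hxs : xs ∈ X) (hmin : ∀ y ∈ X, f xs ≤ f y) (hℓ : ContinuousOn ℓ X)
    (hd : 0 < ‖x₀ - xs‖) (hrε : 0 < rε) (hrd : rε ≤ 3 * ‖x₀ - xs‖) (hδ : 0 < δ)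
    (hδ' : δ < 1 / 2) (hT : 1 ≤ T) (hl : 0 < ℓ x₀)
    (hrun : ∀ ω, IsTDoGRun X ℓ x₀ rε T δ (fun k => x k ω) (fun k => g k ω))
    (hor : IsOracleResponse μ ℱ X f ℓ T x g) :
    ∃ N : Set Ω, μ N ≤ ENNReal.ofReal δ ∧ ∀ ω ∉ N, (∀ k < T, ‖g k ω‖ ≤ ℓ (x k ω)) →
      (∀ k < T, (μ[g k | ℱ k]) ω ∈ subdifferentialOn X f (x k ω)) →
      rbar rε (fun k => x k ω) T ≤ 3 * ‖x₀ - xs‖ := by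
  have h0 : ∀ ω, x 0 ω = x₀ := fun ω => (hrun ω).init
  have hθ4 := four_le_theta hT hδ hδ'
  have hθ : 0 < theta T δ := by linarith
  have hxm : ∀ k ≤ T, Measurable[ℱ k] (x k) := fun k hk =>
    measurable_iterate hX hc h₀ hℓ hrun hor.adapted hk
  -- The step bound 3d/(256θ) and the direction bound 4d turn this scale into 120/256 ≤ 1/2, as
  -- concentration requires.
  set lam := 10 * theta T δ / ‖x₀ - xs‖ ^ 2 with hlam
  have hlam0 : 0 < lam := by positivity
  set w : ℕ → Ω → EuclideanSpace ℝ (Fin n) := fun k ω =>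
    (-(lam * tdogStep ℓ rε T δ (fun k => x k ω) (fun k => g k ω) k))
      • stoppedDirection rε (fun k => x k ω) xs k with hw
  have hwm : ∀ k < T, StronglyMeasurable[ℱ k] (w k) := by
    intro k hk
    have hx : ∀ i ≤ k, Measurable[ℱ k] (x i) := fun i hi =>
      (hxm i (by omega)).mono (ℱ.mono hi) le_rfl
    have h1 := measurable_tdogStep (mΩ := ℱ k) rε T δ hx
      (fun i hi => ((hor.adapted i (by omega)).measurable.mono (ℱ.mono (by omega)) le_rfl :
        Measurable[ℱ k] (g i)))
      fun i hi => measurable_comp_of_continuousOn hX hℓ (hx i hi)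
        fun ω => (hrun ω).mem hX h₀ (show i ≤ T by omega)
    have h2 := measurable_stoppedDirection (mΩ := ℱ k) (rε := rε) (xs := xs) h0 hx
    exact ((h1.const_mul lam).neg.smul h2).stronglyMeasurable
  have hwb : ∀ k < T, ∀ᵐ ω ∂μ, |inner ℝ (g k ω) (w k ω)| ≤ 1 / 2 := by
    intro k hk
    filter_upwards [hor.bounded k hk] with ω hω
    by_cases hr : rbar rε (fun k => x k ω) k ≤ 3 * ‖x 0 ω - xs‖
    · have hs := tdogStep_mul_norm_le (T := T) (δ := δ) (x := fun k => x k ω)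
        (g := fun k => g k ω) hrε hθ (by rwa [h0]) hω
      have hη : 0 ≤ tdogStep ℓ rε T δ (fun k => x k ω) (fun k => g k ω) k :=
        (div_pos (hrε.trans_le (le_rbar rε _ k)) (sqrt_tdogG_pos hθ (by rwa [h0]) k)).le
      have hdir := norm_stoppedDirection_le (rε := rε) (xs := xs) (y := fun k => x k ω) (k := k)
      simp only [h0] at hr hdir
      refine (abs_real_inner_le_norm _ _).trans ?_
      simp only [hw, norm_smul, norm_neg, Real.norm_eq_abs]
      rw [abs_of_nonneg (by positivity)]
      calc _ = lam * (tdogStep ℓ rε T δ (fun k => x k ω) (fun k => g k ω) k * ‖g k ω‖)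
            * ‖stoppedDirection rε (fun k => x k ω) xs k‖ := by ring
        _ ≤ lam * (3 * ‖x₀ - xs‖ / (256 * theta T δ)) * (4 * ‖x₀ - xs‖) := by
            have : rbar rε (fun k => x k ω) k / (256 * theta T δ)
                ≤ 3 * ‖x₀ - xs‖ / (256 * theta T δ) := by gcongr
            gcongr
            exact hs.trans this
        _ = 120 / 256 := by rw [hlam]; field_simp; norm_num
        _ ≤ 1 / 2 := by norm_num
    · simp only [hw]
      rw [stoppedDirection_eq_zero hr, smul_zero, inner_zero_right]
      norm_num
  obtain ⟨N, hN, hN'⟩ :=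
    measure_exists_le_sum_inner_le hor.adapted hor.integrable hwm hwb hδ
  refine ⟨N, hN, fun ω hω hg hm => ?_⟩
  have hcon := hN' ω hω
  have := (hrun ω).rbar_le_of_concentration hX hc h₀ hxs (by simpa only [h0] using hd) hrε
    (by simpa only [h0] using hrd) hT hδ hδ' (by simpa only [h0] using hl) hg
    (m := fun k => (μ[g k | ℱ k]) ω) (fun k hk => ?_) ?_ T le_rfl
  · simpa only [h0] using this
  · have h1 := hm k hk xs hxs
    have h2 := hmin _ ((hrun ω).mem hX h₀ hk.le)
    rw [← neg_sub, inner_neg_right] at h1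
    linarith
  · simpa only [h0, hw] using hcon

/-- With probability at least `1 - δ`, the noise is controlled uniformly in time, as long as the
iterates stay in the ball of radius `3 d₀`. -/
theorem exists_noise_event [IsProbabilityMeasure μ] (hX : IsClosed X) (hc : Convex ℝ X)
    (h₀ : x₀ ∈ X) (hℓ : ContinuousOn ℓ X) (hd : 0 < ‖x₀ - xs‖) (hδ : 0 < δ)
    (hδ' : δ < 1 / 2) (hT : 1 ≤ T) (hL : 0 < localBound X ℓ x₀ xs)
    (hrun : ∀ ω, IsTDoGRun X ℓ x₀ rε T δ (fun k => x k ω) (fun k => g k ω))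
    (hor : IsOracleResponse μ ℱ X f ℓ T x g) :
    ∃ N : Set Ω, μ N ≤ ENNReal.ofReal δ ∧ ∀ ω ∉ N,
      (∀ k < T, ‖g k ω‖ ≤ localBound X ℓ x₀ xs) →
      rbar rε (fun k => x k ω) T ≤ 3 * ‖x₀ - xs‖ → ∀ t ≤ T,
        |∑ k ∈ Finset.range t, inner ℝ (g k ω - (μ[g k | ℱ k]) ω) (x k ω - xs)|
          ≤ 40 * ‖x₀ - xs‖ * Real.log (logPlus T / δ)
            * √(gradSqSumPred (fun k => g k ω) t + localBound X ℓ x₀ xs ^ 2) := by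
  have h0 : ∀ ω, x 0 ω = x₀ := fun ω => (hrun ω).init
  have hxm : ∀ k ≤ T, Measurable[ℱ k] (x k) := fun k hk =>
    measurable_iterate hX hc h₀ hℓ hrun hor.adapted hk
  set L := localBound X ℓ x₀ xs with hLd
  set d := ‖x₀ - xs‖ with hdd
  -- An upper bound for each |⟨g_k, x_k - xs⟩| inside the ball, so even the smallest scale gives
  -- increments at most 1/2.
  set b := 4 * d * L with hb
  have hb0 : 0 < b := by positivity
  set J := Nat.log 2 (T + 1) with hJ
  -- There are J + 1 scales and two signs, so the failure probabilities add up to δ.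
  set p := δ / (2 * ((J : ℝ) + 1)) with hp
  have hp0 : 0 < p := by positivity
  have hev : ∀ σ : ℝ, |σ| = 1 → ∀ j : ℕ, ∃ N : Set Ω, μ N ≤ ENNReal.ofReal p ∧ ∀ ω ∉ N, ∀ t ≤ T,
      ∑ k ∈ Finset.range t, inner ℝ (g k ω - (μ[g k | ℱ k]) ω)
        ((σ * (2 * b * 2 ^ j)⁻¹) • stoppedDirection rε (fun k => x k ω) xs k)
        ≤ Real.log (1 / p) + ∑ k ∈ Finset.range t, inner ℝ (g k ω)
          ((σ * (2 * b * 2 ^ j)⁻¹) • stoppedDirection rε (fun k => x k ω) xs k) ^ 2 := by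
    intro σ hσ j
    refine measure_exists_le_sum_inner_le hor.adapted hor.integrable
      (w := fun k ω => (σ * (2 * b * 2 ^ j)⁻¹) • stoppedDirection rε (fun k => x k ω) xs k)
      (fun k hk => ?_) (fun k hk => ?_) hp0
    · have h2 := measurable_stoppedDirection (mΩ := ℱ k) (rε := rε) (xs := xs) (t := k) h0
        fun i hi => (hxm i (by omega)).mono (ℱ.mono hi) le_rfl
      exact (h2.const_smul (σ * (2 * b * 2 ^ j)⁻¹)).stronglyMeasurable
    · filter_upwards [hor.bounded k hk] with ω hω
      by_cases hr : rbar rε (fun k => x k ω) k ≤ 3 * ‖x 0 ω - xs‖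
      · have hdir := norm_stoppedDirection_le (rε := rε) (xs := xs) (y := fun k => x k ω) (k := k)
        simp only [h0] at hr hdir
        have hgL : ‖g k ω‖ ≤ L := by
          refine hω.trans (le_localBound hX hℓ ((hrun ω).mem hX h₀ hk.le) ?_)
          have := norm_sub_le_rbar (rε := rε) (x := fun k => x k ω) (le_refl k)
          simp only [h0] at this
          exact this.trans hr
        refine (abs_real_inner_le_norm _ _).trans ?_
        rw [norm_smul, Real.norm_eq_abs, abs_mul, hσ, one_mul, abs_of_pos (by positivity)]
        calc _ ≤ L * ((2 * b * 2 ^ j)⁻¹ * (4 * d)) := by gcongr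
          _ ≤ L * ((2 * b)⁻¹ * (4 * d)) := by
              have : 2 * b * 1 ≤ 2 * b * 2 ^ j := by
                gcongr
                exact one_le_pow₀ (by norm_num)
              rw [mul_one] at this
              gcongr
          _ = 1 / 2 := by rw [hb]; field_simp
      · rw [stoppedDirection_eq_zero hr, smul_zero, inner_zero_right]
        norm_num
  choose P hP hP' using hev 1 (by simp)
  choose M hM hM' using hev (-1) (by simp)
  refine ⟨⋃ j ∈ Finset.range (J + 1), (P j ∪ M j), ?_, fun ω hω hg hr t ht => ?_⟩
  · calc μ (⋃ j ∈ Finset.range (J + 1), (P j ∪ M j))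
        ≤ ∑ j ∈ Finset.range (J + 1), μ (P j ∪ M j) := measure_biUnion_finset_le _ _
      _ ≤ ∑ j ∈ Finset.range (J + 1), (ENNReal.ofReal p + ENNReal.ofReal p) :=
          Finset.sum_le_sum fun j _ => (measure_union_le _ _).trans (add_le_add (hP j) (hM j))
      _ = ENNReal.ofReal δ := by
          rw [Finset.sum_const, Finset.card_range, nsmul_eq_mul,
            ← ENNReal.ofReal_add hp0.le hp0.le, ← ENNReal.ofReal_natCast,
            ← ENNReal.ofReal_mul (Nat.cast_nonneg _)]
          congr 1
          rw [hp]; push_cast; field_simp; ring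
  · simp only [Set.mem_iUnion, Finset.mem_range, Set.mem_union, not_exists, not_or] at hω
    have hdir : ∀ k < t, stoppedDirection rε (fun k => x k ω) xs k = x k ω - xs := fun k hk =>
      stoppedDirection_eq (by
        simp only [h0]
        exact (rbar_monotone (by omega)).trans hr)
    set V := ∑ k ∈ Finset.range t, inner ℝ (g k ω) (x k ω - xs) ^ 2 with hV
    set S := ∑ k ∈ Finset.range t, inner ℝ (g k ω - (μ[g k | ℱ k]) ω) (x k ω - xs) with hS
    set G := gradSqSumPred (fun k => g k ω) t with hG
    have hG0 : 0 ≤ G := gradSqSumPred_nonneg t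
    have hVG : V ≤ 16 * d ^ 2 * (G + L ^ 2) := by
      have h1 : V ≤ 16 * d ^ 2 * G := by
        rw [hV, hG, gradSqSumPred, Finset.mul_sum]
        refine Finset.sum_le_sum fun k hk => ?_
        have hk := Finset.mem_range.1 hk
        have h2 := norm_sub_le_four_mul (xs := xs) (x := fun k => x k ω) (show k ≤ T by omega)
          (by simpa only [h0] using hr)
        simp only [h0] at h2
        have h3 := (abs_real_inner_le_norm (g k ω) (x k ω - xs)).trans
          (mul_le_mul_of_nonneg_left h2 (norm_nonneg _))
        rw [← sq_abs]
        calc _ ≤ (‖g k ω‖ * (4 * d)) ^ 2 := by gcongr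
          _ = _ := by ring
      have : 0 ≤ 16 * d ^ 2 * L ^ 2 := by positivity
      linarith
    have hGT : G ≤ T * L ^ 2 := by
      refine (gradSqSumPred_le (L := L) fun k hk => hg k (by omega)).trans ?_
      have : (t : ℝ) ≤ T := by exact_mod_cast ht
      gcongr
    have hA : Real.log (1 / p) ≤ 4 * Real.log (logPlus T / δ) := by
      have := log_scales_le hT hδ hδ'
      rwa [hp, one_div_div]
    have hc3 := half_le_log_logPlus_div hT hδ hδ'
    have hscale : ∀ S' : ℝ, (∀ j ≤ J, (2 * b * 2 ^ j)⁻¹ * S'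
        ≤ Real.log (1 / p) + ((2 * b * 2 ^ j)⁻¹) ^ 2 * V) →
        S' ≤ 40 * d * Real.log (logPlus T / δ) * √(G + L ^ 2) := by
      intro S' hS'
      -- Adding L² to G guarantees U ≥ b², and G ≤ T L² gives U ≤ (T + 1) b²: the scales cover the
      -- whole range of √U.
      have h1 := le_sqrt_mul_of_scales (T := T) (U := 16 * d ^ 2 * (G + L ^ 2))
        (A := 4 * Real.log (logPlus T / δ)) (S := S') hb0 hVG
        (by
          have : 0 ≤ 16 * d ^ 2 * G := by positivity
          rw [hb]; linarith)
        (by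
          have := mul_le_mul_of_nonneg_left hGT (show 0 ≤ 16 * d ^ 2 by positivity)
          rw [hb]; linarith)
        (by positivity) fun j hj => (hS' j hj).trans (by linarith)
      have e : √(16 * d ^ 2 * (G + L ^ 2)) = 4 * d * √(G + L ^ 2) := by
        rw [show 16 * d ^ 2 = (4 * d) ^ 2 by ring, Real.sqrt_mul (sq_nonneg _),
          Real.sqrt_sq (by positivity)]
      rw [e] at h1
      have h2 : 4 * d * √(G + L ^ 2) * (1 + 2 * (4 * Real.log (logPlus T / δ)))
          ≤ 4 * d * √(G + L ^ 2) * (10 * Real.log (logPlus T / δ)) := by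
        gcongr; linarith
      linarith
    have hlin : ∀ a : ℝ, ∑ k ∈ Finset.range t, inner ℝ (g k ω - (μ[g k | ℱ k]) ω)
        (a • stoppedDirection rε (fun k => x k ω) xs k) = a * S := by
      intro a
      rw [hS, Finset.mul_sum]
      refine Finset.sum_congr rfl fun k hk => ?_
      rw [hdir k (Finset.mem_range.1 hk), inner_smul_right]
    have hquad : ∀ a : ℝ, ∑ k ∈ Finset.range t, inner ℝ (g k ω)
        (a • stoppedDirection rε (fun k => x k ω) xs k) ^ 2 = a ^ 2 * V := by
      intro a
      rw [hV, Finset.mul_sum]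
      refine Finset.sum_congr rfl fun k hk => ?_
      rw [hdir k (Finset.mem_range.1 hk), inner_smul_right, mul_pow]
    refine abs_le'.2 ⟨hscale S fun j hj => ?_, hscale (-S) fun j hj => ?_⟩
    · have := hP' j ω (hω j (by omega)).1 t ht
      rwa [hlin, hquad, one_mul] at this
    · have := hM' j ω (hω j (by omega)).2 t ht
      rw [hlin, hquad] at this
      linarith

end Probability

/-! ### Assembly of the theorem -/

theorem mainTheorem1 :
    ∃ C₁ C₂ : ℝ, 0 < C₁ ∧ 0 < C₂ ∧
      ∀ (n : ℕ) (X : Set (EuclideanSpace ℝ (Fin n)))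
        (f ℓ : EuclideanSpace ℝ (Fin n) → ℝ) (x₀ xs : EuclideanSpace ℝ (Fin n))
        (rε δ : ℝ) (T : ℕ)
        (Ω : Type*) (m : MeasurableSpace Ω) (μ : Measure Ω) (ℱ : Filtration ℕ m)
        (x g : ℕ → Ω → EuclideanSpace ℝ (Fin n)),
        IsClosed X → ConvexOn ℝ X f → xs ∈ X → (∀ y ∈ X, f xs ≤ f y) →
        ContinuousOn ℓ X →
        x₀ ∈ X → f xs < f x₀ →
        0 < rε → rε ≤ 3 * ‖x₀ - xs‖ →
        0 < δ → δ < 1 / 2 → 1 ≤ T →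
        IsProbabilityMeasure μ →
        (∀ ω, IsTDoGRun X ℓ x₀ rε T δ (fun k => x k ω) (fun k => g k ω)) →
        IsOracleResponse μ ℱ X f ℓ T x g →
        ∃ A : Set Ω, MeasurableSet A ∧ ENNReal.ofReal (1 - 2 * δ) ≤ μ A ∧
          ∀ ω ∈ A, ∀ τ : ℕ, IsBestIndex rε (fun k => x k ω) T τ →
            f (weightedAvg rε (fun k => x k ω) τ) - f xs ≤
              C₁ * (logFactor T δ rε ‖x₀ - xs‖ (localBound X ℓ x₀ xs) (f x₀ - f xs) *
                (‖x₀ - xs‖ * √(gradSqSumPred (fun k => g k ω) τ + localBound X ℓ x₀ xs ^ 2)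
                  / (T : ℝ))) ∧
            C₁ * (logFactor T δ rε ‖x₀ - xs‖ (localBound X ℓ x₀ xs) (f x₀ - f xs) *
                (‖x₀ - xs‖ * √(gradSqSumPred (fun k => g k ω) τ + localBound X ℓ x₀ xs ^ 2)
                  / (T : ℝ))) ≤
              C₂ * (logFactor T δ rε ‖x₀ - xs‖ (localBound X ℓ x₀ xs) (f x₀ - f xs) *
                (‖x₀ - xs‖ * localBound X ℓ x₀ xs / √(T : ℝ))) := by
  refine ⟨100000, 200000, by norm_num, by norm_num, ?_⟩
  intro n X f ℓ x₀ xs rε δ T Ω m μ ℱ x g hX hf hxs hmin hℓ h₀ hgap hrε hrd hδ hδ' hT hμ hrun hor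
  have h0 : ∀ ω, x 0 ω = x₀ := fun ω => (hrun ω).init
  have hd : 0 < ‖x₀ - xs‖ := by
    rw [norm_sub_pos_iff]
    rintro rfl
    exact lt_irrefl _ hgap
  have hgl := hor.sub_le_mul_norm hxs h0 hT
  -- Positivity of ℓ(x₀) is not assumed; it follows from the positive initial gap.
  have hl : 0 < ℓ x₀ := pos_of_mul_pos_left ((sub_pos.2 hgap).trans_le hgl) hd.le
  have hlL : ℓ x₀ ≤ localBound X ℓ x₀ xs := le_localBound hX hℓ h₀ (by simp)
  have hL : 0 < localBound X ℓ x₀ xs := hl.trans_le hlL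
  obtain ⟨N₁, hN₁, hstab⟩ := exists_stability_event hX hf.1 h₀ hxs hmin hℓ hd hrε hrd hδ hδ' hT hl
    hrun hor
  obtain ⟨N₂, hN₂, hnoise⟩ := exists_noise_event (rε := rε) hX hf.1 h₀ hℓ hd hδ hδ' hT hL hrun hor
  have hae : ∀ᵐ ω ∂μ, ∀ k ∈ Finset.range T, ‖g k ω‖ ≤ ℓ (x k ω) ∧
      (μ[g k | ℱ k]) ω ∈ subdifferentialOn X f (x k ω) := by
    rw [Finset.eventually_all]
    intro k hk
    have hk := Finset.mem_range.1 hk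
    filter_upwards [hor.bounded k hk, hor.unbiased k hk] with ω h1 h2
    exact ⟨h1, h2⟩
  have hN₃ := ae_iff.1 hae
  set N₃ := {ω | ¬ ∀ k ∈ Finset.range T, ‖g k ω‖ ≤ ℓ (x k ω) ∧
      (μ[g k | ℱ k]) ω ∈ subdifferentialOn X f (x k ω)}
  have hN : μ (N₁ ∪ N₂ ∪ N₃) ≤ ENNReal.ofReal (2 * δ) := by
    refine (measure_union_le _ _).trans ?_
    rw [hN₃, add_zero, two_mul, ENNReal.ofReal_add hδ.le hδ.le]
    exact (measure_union_le _ _).trans (add_le_add hN₁ hN₂)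
  -- The exceptional sets need not be measurable, so the complement of a measurable hull of the same
  -- measure is used.
  refine ⟨(toMeasurable μ (N₁ ∪ N₂ ∪ N₃))ᶜ, (measurableSet_toMeasurable _ _).compl, ?_, ?_⟩
  · rw [prob_compl_eq_one_sub (measurableSet_toMeasurable _ _), measure_toMeasurable,
      ENNReal.ofReal_sub _ (by positivity), ENNReal.ofReal_one]
    exact tsub_le_tsub_left hN 1
  intro ω hω τ hτ
  have hω' : ω ∉ N₁ ∪ N₂ ∪ N₃ := fun h => hω (subset_toMeasurable _ _ h)
  simp only [Set.mem_union, not_or] at hω'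
  obtain ⟨⟨hω₁, hω₂⟩, hω₃⟩ := hω'
  have hω₃ : ∀ k < T, ‖g k ω‖ ≤ ℓ (x k ω) ∧
      (μ[g k | ℱ k]) ω ∈ subdifferentialOn X f (x k ω) := fun k hk =>
    not_not.1 hω₃ k (Finset.mem_range.2 hk)
  have hr := hstab ω hω₁ (fun k hk => (hω₃ k hk).1) fun k hk => (hω₃ k hk).2
  have hxL : ∀ k ≤ T, ℓ (x k ω) ≤ localBound X ℓ x₀ xs := fun k hk =>
    le_localBound hX hℓ ((hrun ω).mem hX h₀ hk) (by
      have := norm_sub_le_rbar (rε := rε) (x := fun k => x k ω) hk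
      simp only [h0] at this
      exact this.trans hr)
  have hgL : ∀ k < T, ‖g k ω‖ ≤ localBound X ℓ x₀ xs := fun k hk =>
    (hω₃ k hk).1.trans (hxL k hk.le)
  have hz : localBound X ℓ x₀ xs / ℓ x₀
      ≤ ‖x₀ - xs‖ * localBound X ℓ x₀ xs / (f x₀ - f xs) := by
    rw [div_le_div_iff₀ hl (sub_pos.2 hgap)]
    have := mul_le_mul_of_nonneg_left hgl hL.le
    linarith
  have hz1 : 1 ≤ ‖x₀ - xs‖ * localBound X ℓ x₀ xs / (f x₀ - f xs) :=
    le_trans (by rw [le_div_iff₀ hl]; linarith) hz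
  have hT1 : (1 : ℝ) ≤ T := by exact_mod_cast hT
  constructor
  · have := (hrun ω).weightedAvg_sub_le hX hf h₀ hxs hrε hT hδ hδ' (by simpa only [h0] using hl)
      (fun k hk => (hω₃ k hk).1) (m := fun k => (μ[g k | ℱ k]) ω) (fun k hk => (hω₃ k hk).2)
      (by simpa only [h0] using hr) hxL (by simpa only [h0] using hz)
      (by simpa only [h0] using hnoise ω hω₂ hgL hr) hτ
    simpa only [h0, logFactor] using this
  · have hc : 0 ≤ logFactor T δ rε ‖x₀ - xs‖ (localBound X ℓ x₀ xs) (f x₀ - f xs) := by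
      have h1 := half_le_log_logPlus_div hT hδ hδ'
      have h2 : 1 ≤ logPlus (3 * ‖x₀ - xs‖ / rε) :=
        one_le_logPlus (by rw [le_div_iff₀ hrε]; linarith)
      have h3 := one_le_logPlus (one_le_mul_of_one_le_of_one_le hT1 hz1)
      unfold logFactor
      positivity
    -- Here G + L² ≤ (T + 1) L² ≤ 4 T L², whence the second constant is twice the first.
    have hG : √(gradSqSumPred (fun k => g k ω) τ + localBound X ℓ x₀ xs ^ 2)
        ≤ 2 * (localBound X ℓ x₀ xs * √T) := by
      refine Real.sqrt_le_iff.2 ⟨by positivity, ?_⟩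
      have h1 := gradSqSumPred_le (g := fun k => g k ω) (t := τ) (L := localBound X ℓ x₀ xs)
        fun k hk => hgL k (hk.trans_le hτ.1)
      have h2 : (τ : ℝ) ≤ T := by exact_mod_cast hτ.1
      rw [mul_pow, mul_pow, Real.sq_sqrt (by positivity)]
      nlinarith [sq_nonneg (localBound X ℓ x₀ xs)]
    have hT0 : (0 : ℝ) < T := by linarith
    have e : ‖x₀ - xs‖ * (2 * (localBound X ℓ x₀ xs * √T)) / T
        = 2 * (‖x₀ - xs‖ * localBound X ℓ x₀ xs / √T) := by
      have : √(T : ℝ) * √T = T := Real.mul_self_sqrt hT0.le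
      have hs : 0 < √(T : ℝ) := Real.sqrt_pos.2 hT0
      rw [← mul_div_assoc, div_eq_div_iff hT0.ne' hs.ne']
      linear_combination 2 * ‖x₀ - xs‖ * localBound X ℓ x₀ xs * this
    calc _ ≤ 100000 * (logFactor T δ rε ‖x₀ - xs‖ (localBound X ℓ x₀ xs) (f x₀ - f xs)
          * (‖x₀ - xs‖ * (2 * (localBound X ℓ x₀ xs * √T)) / T)) := by gcongr
      _ = _ := by rw [e]; ring
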